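/- Let $n\ge 2$. Let $\nu\ge 0$ and $\tau>0$ be functions on $[0,\infty)$ such that $s\mapsto\nu(s)/s$ (on $(0,\infty)$) and $\tau$ are Lipschitz and bounded, and such that $k=\nu/\tau$ is (strictly) increasing, with inverse $j:[0,\kappa_{\max})\to[0,\infty)$, $\kappa_{\max}=\lim_{s\to\infty}k(s)$. Let $$c(\kappa)=\frac{\int_0^\pi\cos\theta\,e^{\kappa\cos\theta}\sin^{n-2}\theta\,d\theta}{\int_0^\pi e^{\kappa\cos\theta}\sin^{n-2}\theta\,d\theta}$$ be the order parameter of the von Mises--Fisher distribution on the unit sphere $\mathbb S$ of $\mathbb R^n$. Assume that there is a second-order phase transition, i.e. $(j/c)'(\kappa)>0$ for all $\kappa\in(0,\kappa_{\max})$, and put $\rho_c=\lim_{\kappa\to0}j(\kappa)/c(\kappa)$. For $\rho>\rho_c$ let $\kappa=\kappa(\rho)>0$ be the unique positive solution of $j(\kappa)=\rho\,c(\kappa)$, and let $\alpha(\rho)=c(\kappa(\rho))$. For $\kappa>0$ let $g_\kappa$ be the unique solution, in the space $V$ of functions $g$ with $(n-2)(\sin\theta)^{\frac n2-2}g\in L^2(0,\pi)$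 and $(\sin\theta)^{\frac n2-1}g\in H^1_0(0,\pi)$, of $$-\sin^{2-n}\theta\,e^{-\kappa\cos\theta}\frac{d}{d\theta}\Big(\sin^{n-2}\theta\,e^{\kappa\cos\theta}g'(\theta)\Big)+\frac{n-2}{\sin^2\theta}g(\theta)=\sin\theta ,$$ let $h_\kappa(\cos\theta)=g_\kappa(\theta)/\sin\theta$, and set $$\widetilde c(\kappa)=\frac{\int_0^\pi\cos\theta\,h_\kappa(\cos\theta)e^{\kappa\cos\theta}\sin^n\theta\,d\theta}{\int_0^\pi h_\kappa(\cos\theta)e^{\kappa\cos\theta}\sin^n\theta\,d\theta},\qquad \Theta(\rho)=\frac1\kappa+(\widetilde c(\kappa)-c(\kappa))\,\frac{\rho}{\kappa}\,\frac{d\kappa}{d\rho}\quad(\kappa=\kappa(\rho)).$$ The self-organized hydrodynamic (SOH) model, for a density $\rho(x,t)>\rho_c$ and an orientation $\Omega(x,t)\in\mathbb S$, has first-order part $$\partial_t\rho+\nabla_x\cdot(\rho c_1\Omega)=0,\qquad \rho\big(\partial_t\Omega+c_2(\Omega\cdot\nabla_x)\Omega\big)+\Theta\,P_{\Omega^\perp}\nabla_x\rho=0,$$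 with $c_1(\rho)=c(\kappa(\rho))$, $c_2(\rho)=\widetilde c(\kappa(\rho))$ and $P_{\Omega^\perp}$ the orthogonal projection onto $\Omega^\perp$. It is called hyperbolic at a state $(\rho,\Omega)$ if, for every direction $\xi\in\mathbb R^n$, the symbol of this system (a linear endomorphism of $\mathbb R\times\Omega^\perp$) is diagonalizable over $\mathbb R$. Suppose that there is a critical exponent $\beta$, i.e. there is $\alpha_0>0$ with $\alpha(\rho)\sim\alpha_0(\rho-\rho_c)^\beta$ as $\rho\to\rho_c$, $\rho>\rho_c$, and that this also holds at the level of the derivative: $$\frac{d\kappa}{d\rho}\sim n\,\alpha_0\,\beta\,(\rho-\rho_c)^{\beta-1}\quad\text{as }\rho\to\rho_c,\ \rho>\rho_c .$$ Then: (i) If $\beta<\frac12$, then for all $\rho>\rho_c$ sufficiently close to $\rho_c$ we have $\Theta(\rho)<0$, and the SOH model is not hyperbolic at $(\rho,\Omega)$ for any $\Omega\in\mathbb S$. (ii) If $\beta>\frac12$, then for all $\rho>\rho_c$ sufficiently close to $\rho_c$ we have $\Theta(\rho)>0$, and the SOH model is hyperbolic at $(\rho,\Omega)$ for every $\Omega\in\mathbb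 S$. (iii) If $\beta=\frac12$ and $\alpha_0\ne\sqrt{\frac{4(n+2)}{5n\rho_c}}$, then for all $\rho>\rho_c$ sufficiently close to $\rho_c$, $\Theta(\rho)$ has the sign of $\sqrt{\frac{4(n+2)}{5n\rho_c}}-\alpha_0$. -/

import Mathlib

open scoped Real Topology RealInnerProductSpace

noncomputable section

namespace SOH

/-! ### The rates `ν`, `τ`, the ratio `k = ν / τ` and its inverse `j` -/

/-- Assumptions on the alignment rate `ν` and the noise intensity `τ`, both functions of
`|J| ∈ [0, ∞)`; the values at negative arguments are irrelevant. -/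
structure Rates (ν τ : ℝ → ℝ) : Prop where
  nu_nonneg : ∀ s, 0 ≤ s → 0 ≤ ν s
  tau_pos : ∀ s, 0 ≤ s → 0 < τ s
  nu_div_lipschitz : ∃ L, LipschitzOnWith L (fun s => ν s / s) (Set.Ioi 0)
  nu_div_bounded : ∃ C, ∀ s, 0 < s → |ν s / s| ≤ C
  tau_lipschitz : ∃ L, LipschitzOnWith L τ (Set.Ici 0)
  tau_bounded : ∃ C, ∀ s, 0 ≤ s → |τ s| ≤ C
  ratio_increasing : StrictMonoOn (fun s => ν s / τ s) (Set.Ici 0)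

/-- `k(|J|) = ν(|J|) / τ(|J|)`. -/
def ratio (ν τ : ℝ → ℝ) (s : ℝ) : ℝ := ν s / τ s

/-- The inverse `j` of `k : [0, ∞) → [0, κ_max)`. -/
def inverseRatio (k : ℝ → ℝ) : ℝ → ℝ := Function.invFunOn k (Set.Ici 0)

/-- The open interval `(0, κ_max)`, as the image of `(0, ∞)` under `k`. -/
def kappaRange (k : ℝ → ℝ) : Set ℝ := k '' Set.Ioi 0

/-! ### Von Mises--Fisher order parameter and the branch of equilibria -/

/-- The order parameter `c(κ)` of the von Mises--Fisher distribution on the unit sphere of `ℝⁿ`,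
for `n ≥ 2`. -/
def vmfOrder (n : ℕ) (κ : ℝ) : ℝ :=
  (∫ θ in (0 : ℝ)..π, Real.cos θ * Real.exp (κ * Real.cos θ) * Real.sin θ ^ (n - 2)) /
    ∫ θ in (0 : ℝ)..π, Real.exp (κ * Real.cos θ) * Real.sin θ ^ (n - 2)

/-- `κ ↦ j(κ) / c(κ)`. -/
def densityOfKappa (n : ℕ) (k : ℝ → ℝ) (κ : ℝ) : ℝ := inverseRatio k κ / vmfOrder n κ

/-- The solution `κ > 0` of the compatibility equation `j(κ) = ρ c(κ)`. -/
def kappaOf (n : ℕ) (k : ℝ → ℝ) (ρ : ℝ) : ℝ :=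
  Classical.epsilon fun κ =>
    0 < κ ∧ κ ∈ kappaRange k ∧ inverseRatio k κ = ρ * vmfOrder n κ

/-- The order parameter `α(ρ)` of the stable equilibrium of mass `ρ`. -/
def orderParameter (n : ℕ) (k : ℝ → ℝ) (ρc ρ : ℝ) : ℝ :=
  if ρ ≤ ρc then 0 else vmfOrder n (kappaOf n k ρ)

/-! ### Generalized collisional invariants -/

/-- `u ∈ H¹₀(0, π)`, for the continuous representative `u`: it is the primitive, vanishing at `0`
and at `π`, of a function in `L²(0, π)`. -/
def MemH10 (u : ℝ → ℝ) : Prop :=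
  ∃ v : ℝ → ℝ, MeasureTheory.MemLp v 2 (MeasureTheory.volume.restrict (Set.Ioo 0 π)) ∧
    (∀ x ∈ Set.Ioo 0 π, u x = ∫ t in (0 : ℝ)..x, v t) ∧ ∫ t in (0 : ℝ)..π, v t = 0

/-- `g` belongs to the space `V` and solves `L̃*_κ g = sin` on `(0, π)`. The coefficients of the
equation are smooth on `(0, π)`, so its weak solutions there are classical ones. -/
structure IsGCISolution (n : ℕ) (κ : ℝ) (g : ℝ → ℝ) : Prop where
  contDiffOn : ContDiffOn ℝ 2 g (Set.Ioo 0 π)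
  equation : ∀ θ ∈ Set.Ioo 0 π,
    -((Real.sin θ ^ (n - 2))⁻¹ * Real.exp (-(κ * Real.cos θ)) *
        deriv (fun t => Real.sin t ^ (n - 2) * Real.exp (κ * Real.cos t) * deriv g t) θ) +
      ((n : ℝ) - 2) / Real.sin θ ^ 2 * g θ = Real.sin θ
  memL2 : MeasureTheory.MemLp
    (fun θ => ((n : ℝ) - 2) * Real.sin θ ^ ((n : ℝ) / 2 - 2) * g θ) 2
    (MeasureTheory.volume.restrict (Set.Ioo 0 π))
  memH10 : MemH10 fun θ => Real.sin θ ^ ((n : ℝ) / 2 - 1) * g θ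

/-- The solution `g_κ` (its values outside `(0, π)` are irrelevant). -/
def gciProfile (n : ℕ) (κ : ℝ) : ℝ → ℝ := Classical.epsilon (IsGCISolution n κ)

/-- The function `h_κ`, with `h_κ(cos θ) = g_κ(θ) / sin θ`. -/
def gciH (n : ℕ) (κ x : ℝ) : ℝ := gciProfile n κ (Real.arccos x) / Real.sin (Real.arccos x)

/-- The coefficient `c̃(κ)`. -/
def cTilde (n : ℕ) (κ : ℝ) : ℝ :=
  (∫ θ in (0 : ℝ)..π, Real.cos θ * gciH n κ (Real.cos θ) * Real.exp (κ * Real.cos θ) *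
      Real.sin θ ^ n) /
    ∫ θ in (0 : ℝ)..π, gciH n κ (Real.cos θ) * Real.exp (κ * Real.cos θ) * Real.sin θ ^ n

/-! ### The SOH model -/

/-- The coefficient `c₁(ρ) = c(κ(ρ))`. -/
def coeffC1 (n : ℕ) (k : ℝ → ℝ) (ρ : ℝ) : ℝ := vmfOrder n (kappaOf n k ρ)

/-- The coefficient `c₂(ρ) = c̃(κ(ρ))`. -/
def coeffC2 (n : ℕ) (k : ℝ → ℝ) (ρ : ℝ) : ℝ := cTilde n (kappaOf n k ρ)

/-- The coefficient `Θ(ρ) = 1/κ + (c̃ - c) (ρ/κ) dκ/dρ`. -/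
def Theta (n : ℕ) (k : ℝ → ℝ) (ρ : ℝ) : ℝ :=
  1 / kappaOf n k ρ +
    (cTilde n (kappaOf n k ρ) - vmfOrder n (kappaOf n k ρ)) *
      (ρ / kappaOf n k ρ) * deriv (kappaOf n k) ρ

/-- The tangent space `Ω^⊥` of the sphere at `Ω`. -/
abbrev tangent {n : ℕ} (Ω : EuclideanSpace ℝ (Fin n)) : Submodule ℝ (EuclideanSpace ℝ (Fin n)) :=
  (Submodule.span ℝ {Ω})ᗮ

/-- The symbol, at the state `(ρ, Ω)` and in the direction `ξ`, of the first-order part of the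
system
`∂ₜρ + ∇·(ρ c₁ Ω) = 0`, `ρ (∂ₜΩ + c₂ (Ω·∇)Ω) + Θ P_{Ω^⊥} ∇ρ = 0`, `|Ω| = 1`,
written as `∂ₜU + A(U, ∇)U = 0`: inserting `∇ρ = r ξ` and `∂_{x_i}Ω = ξ_i w` with `w ⊥ Ω` gives
`(r, w) ↦ ((ρ c₁)' (Ω·ξ) r + ρ c₁ (ξ·w), c₂ (Ω·ξ) w + (Θ/ρ) r P_{Ω^⊥} ξ)`. -/
def symbol {n : ℕ} (c₁ c₂ T : ℝ → ℝ) (ρ : ℝ) (Ω ξ : EuclideanSpace ℝ (Fin n)) :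
    Module.End ℝ (ℝ × tangent Ω) where
  toFun p :=
    (deriv (fun r => r * c₁ r) ρ * ⟪Ω, ξ⟫ * p.1 +
        ρ * c₁ ρ * ⟪ξ, (p.2 : EuclideanSpace ℝ (Fin n))⟫,
      (c₂ ρ * ⟪Ω, ξ⟫) • p.2 + (T ρ / ρ * p.1) • (tangent Ω).orthogonalProjectionOnto ξ)
  map_add' p q := by
    ext1
    · simp [inner_add_right]; ring
    · simp only [Prod.fst_add, Prod.snd_add, smul_add, mul_add, add_smul]; abel
  map_smul' a p := by
    ext1
    · simp [inner_smul_right]; ring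
    · simp only [Prod.smul_fst, Prod.smul_snd, smul_add, smul_smul, smul_eq_mul,
        RingHom.id_apply]
      congr 2 <;> ring

/-- The SOH model is hyperbolic at the state `(ρ, Ω)`: in every direction its symbol is
diagonalizable over `ℝ`. -/
def HyperbolicAt (n : ℕ) (k : ℝ → ℝ) (ρ : ℝ) (Ω : EuclideanSpace ℝ (Fin n)) : Prop :=
  ∀ ξ : EuclideanSpace ℝ (Fin n),
    ⨆ μ : ℝ, (symbol (coeffC1 n k) (coeffC2 n k) (Theta n k) ρ Ω ξ).eigenspace μ = ⊤

end SOH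

end

noncomputable section

namespace SOH

/-! ### A maximum principle for polynomials on `[-1, 1]` -/

/-! Everything rests on `κ Θ = 1 + (c̃ - c) ρ dκ/dρ` together with first-order expansions as `κ →
0`: `c ~ κ / n` and `c̃ ~ (2n - 1) κ / (2n(n + 2))`, so that `c̃ - c ~ -5κ / (2n(n + 2))`. The
branch satisfies `κ → 0` as `ρ ↓ ρ_c` (`Rates.tendsto_kappaOf`), hence `κ ~ n α₀ (ρ - ρ_c)^β`. With
the assumed asymptotics of `dκ/dρ`, the correction to `1` is asymptotic to a negative constant times
`(ρ - ρ_c)^(2β - 1)` (`Rates.exists_theta_expansion`). It blows up, vanishes or has a finite limit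
according to the position of `β` relative to `1/2`.

The expansion of `c̃` is the analytic core. In the variable `x = cos θ` the profile `h_κ` solves a
Gegenbauer-type equation perturbed by `κ`. It is expanded as a power series in `κ` with polynomial
coefficients, bounded by `2 ^ m` together with two derivatives through a maximum principle
(`IsProfileSeq.abs_eval_le`, `exists_profile`). The sum gives an element of `V`
(`isGCISolution_of_profile`). Uniqueness in `V` (`IsGCISolution.eqOn`) identifies it with the chosen
`g_κ`.

Hyperbolicity reduces to the sign of `Θ`, since `ρ` and `c₁` are positive. If `Θ > 0`, rescaling the
density component makes every symbol symmetric. If `Θ < 0`, a direction `ξ ⊥ Ω` gives a symbol whose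
square has a negative eigenvalue. -/

lemma second_deriv_nonpos_of_isMax {f f' : ℝ → ℝ} {f'' x₀ : ℝ}
    (hf : ∀ x, HasDerivAt f (f' x) x) (hf' : HasDerivAt f' f'' x₀)
    (hmax : ∀ x, f x ≤ f x₀) : f' x₀ = 0 ∧ f'' ≤ 0 := by
  have hd : deriv f = f' := funext fun x => (hf x).deriv
  have hloc : IsLocalMax f x₀ := Filter.Eventually.of_forall hmax
  have h0 : f' x₀ = 0 := by rw [← hd]; exact hloc.deriv_eq_zero
  refine ⟨h0, ?_⟩
  -- A positive second derivative would make the maximum a local minimum as well, so `f` would be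
  -- locally constant and `f''` would vanish.
  by_contra! hpos
  have hmin : IsLocalMin f x₀ :=
    isLocalMin_of_deriv_deriv_pos (by rwa [hd, hf'.deriv]) (by rw [hd, h0]) (hf x₀).continuousAt
  have heq : f =ᶠ[𝓝 x₀] fun _ => f x₀ := by
    filter_upwards [hmin] with x hx using le_antisymm (hmax x) hx
  have hd0 : f' =ᶠ[𝓝 x₀] fun _ => 0 := by
    have := heq.deriv
    rw [hd] at this
    simpa using this
  have := (hf'.congr_of_eventuallyEq hd0.symm).unique (hasDerivAt_const x₀ (0 : ℝ))
  exact hpos.ne' this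

open Polynomial in
/-- The operator `q ↦ -(1 - X²) q'' + a X q' + b q`. -/
def gegenbauerOp (a b : ℝ) (q : ℝ[X]) : ℝ[X] :=
  -((1 - X ^ 2) * derivative (derivative q)) + C a * X * derivative q + C b * q

open Polynomial in
-- Maximum principle: at a maximum point the derivative terms contribute a nonnegative amount,
-- leaving `b q ≤ M`. Writing `x = cos θ` turns the endpoints `±1` into interior critical points, so
-- no boundary condition is needed.
lemma eval_le_of_gegenbauerOp_le {a b M : ℝ} (ha : 1 ≤ a) (hb : 0 < b) (q : ℝ[X])
    (h : ∀ x ∈ Set.Icc (-1 : ℝ) 1, (gegenbauerOp a b q).eval x ≤ M) :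
    ∀ x ∈ Set.Icc (-1 : ℝ) 1, q.eval x ≤ M / b := by
  obtain ⟨x₀, hx₀, hmax⟩ := isCompact_Icc.exists_isMaxOn (s := Set.Icc (-1 : ℝ) 1) ⟨0, by simp⟩
    (f := fun x => q.eval x) q.continuous.continuousOn
  have key : 0 ≤ -((1 - x₀ ^ 2) * (derivative (derivative q)).eval x₀) +
      a * x₀ * (derivative q).eval x₀ := by
    have hc : Real.cos (Real.arccos x₀) = x₀ := Real.cos_arccos hx₀.1 hx₀.2
    obtain ⟨h1, h2⟩ := second_deriv_nonpos_of_isMax (x₀ := Real.arccos x₀)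
      (f := fun θ => q.eval (Real.cos θ))
      (f' := fun θ => (derivative q).eval (Real.cos θ) * -Real.sin θ)
      (fun θ => (q.hasDerivAt _).comp θ (Real.hasDerivAt_cos θ))
      ((((derivative q).hasDerivAt _).comp _ (Real.hasDerivAt_cos _)).mul
        (Real.hasDerivAt_sin _).neg)
      (fun θ => by rw [hc]; exact hmax ⟨Real.neg_one_le_cos θ, Real.cos_le_one θ⟩)
    have hs := Real.sin_sq_add_cos_sq (Real.arccos x₀)
    simp only [Function.comp_apply] at h1 h2
    rw [hc] at h1 h2 hs
    set s := Real.sin (Real.arccos x₀)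
    set d := (derivative q).eval x₀
    set e := (derivative (derivative q)).eval x₀
    rcases mul_eq_zero.1 h1 with h | h
    · have : (1 - x₀ ^ 2) * e = e * -s * -s := by linear_combination -e * hs
      rw [h] at h2 ⊢
      linarith
    · have hs0 : s = 0 := by linarith
      have : 1 - x₀ ^ 2 = 0 := by nlinarith
      rw [this]
      rw [hs0] at h2
      nlinarith
  intro x hx
  refine (hmax hx).trans ?_
  rw [le_div_iff₀ hb]
  have := h x₀ hx₀
  simp only [gegenbauerOp, eval_add, eval_neg, eval_mul, eval_sub, eval_one, eval_pow, eval_X,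
    eval_C] at this
  linarith

open Polynomial in
lemma abs_eval_le_of_gegenbauerOp {a b M : ℝ} (ha : 1 ≤ a) (hb : 0 < b) (q : ℝ[X])
    (h : ∀ x ∈ Set.Icc (-1 : ℝ) 1, |(gegenbauerOp a b q).eval x| ≤ M) :
    ∀ x ∈ Set.Icc (-1 : ℝ) 1, |q.eval x| ≤ M / b := by
  intro x hx
  rw [abs_le]
  constructor
  · have := eval_le_of_gegenbauerOp_le ha hb (-q) (M := M) (fun y hy => by
      have h1 := (abs_le.1 (h y hy)).1
      have : gegenbauerOp a b (-q) = -gegenbauerOp a b q := by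
        simp only [gegenbauerOp, derivative_neg]; ring
      rw [this, eval_neg]; linarith) x hx
    rw [eval_neg] at this
    linarith
  · exact eval_le_of_gegenbauerOp_le ha hb q (fun y hy => (abs_le.1 (h y hy)).2) x hx

open Polynomial in
lemma gegenbauerOp_surjective {a b : ℝ} (ha : 1 ≤ a) (hb : 0 < b) :
    Function.Surjective (gegenbauerOp a b) := by
  have hadd : ∀ p q, gegenbauerOp a b (p + q) = gegenbauerOp a b p + gegenbauerOp a b q := by
    intro p q; simp only [gegenbauerOp, derivative_add]; ring
  have hsmul : ∀ (c : ℝ) q, gegenbauerOp a b (C c * q) = C c * gegenbauerOp a b q := by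
    intro c q; simp only [gegenbauerOp, derivative_C_mul]; ring
  -- The operator is triangular on monomials: `X ^ (d + 2)` goes to `r X ^ (d + 2) - (d + 2)(d + 1)
  -- X ^ d` with `r > 0`, whence an induction in steps of two.
  have hmono : ∀ d : ℕ, ∃ q, gegenbauerOp a b q = X ^ d := by
    intro d
    induction d using Nat.strong_induction_on with
    | _ d ih =>
      match d, ih with
      | 0, _ => exact ⟨C b⁻¹, by
          simp only [gegenbauerOp, derivative_C, derivative_zero, mul_zero, neg_zero, zero_add,
            pow_zero, ← C_mul, mul_inv_cancel₀ hb.ne', C_1]⟩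
      | 1, _ => exact ⟨C (a + b)⁻¹ * X, by
          have h : C (a + b)⁻¹ * (C a + C b) = (1 : ℝ[X]) := by
            rw [← C_add, ← C_mul, inv_mul_cancel₀ (by linarith), C_1]
          rw [hsmul]
          simp only [gegenbauerOp, derivative_X, derivative_one, mul_zero, neg_zero, zero_add,
            mul_one]
          linear_combination X * h⟩
      | d + 2, ih =>
        obtain ⟨q, hq⟩ := ih d (by omega)
        set r : ℝ := (d + 2) * (d + 1) + a * (d + 2) + b
        have hr : r ≠ 0 := by positivity
        refine ⟨C r⁻¹ * (X ^ (d + 2) + C (((d : ℝ) + 2) * (d + 1)) * q), ?_⟩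
        have h : (C r⁻¹ * C r : ℝ[X]) = 1 := by
          rw [← C_mul, inv_mul_cancel₀ hr, C_1]
        have h2C : (C 2 : ℝ[X]) = 2 := rfl
        have hr' : (C r : ℝ[X]) = (d + 2) * (d + 1) + C a * (d + 2) + C b := by simp [r, h2C]
        have hc : (C (((d : ℝ) + 2) * (d + 1)) : ℝ[X]) = (d + 2) * (d + 1) := by simp [h2C]
        have h1 : derivative (X ^ (d + 2) : ℝ[X]) = ((d : ℝ[X]) + 2) * X ^ (d + 1) := by
          simp; ring
        have h2 : derivative (((d : ℝ[X]) + 2) * X ^ (d + 1)) =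
            ((d : ℝ[X]) + 2) * (((d : ℝ[X]) + 1) * X ^ d) := by
          simp [derivative_mul]
        rw [hsmul, hadd, hsmul, hq, hc]
        simp only [gegenbauerOp, h1, h2]
        rw [hr'] at h
        linear_combination (X : ℝ[X]) ^ (d + 2) * h
  intro f
  induction f using Polynomial.induction_on' with
  | add p q hp hq =>
    obtain ⟨p', rfl⟩ := hp
    obtain ⟨q', rfl⟩ := hq
    exact ⟨p' + q', hadd _ _⟩
  | monomial d c =>
    obtain ⟨q, hq⟩ := hmono d
    exact ⟨C c * q, by rw [hsmul, hq, C_mul_X_pow_eq_monomial]⟩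

open Polynomial in
-- Differentiation stays inside the family and enlarges the zero-order coefficient, so the maximum
-- principle also bounds derivatives of solutions.
lemma derivative_gegenbauerOp (a b : ℝ) (q : ℝ[X]) :
    derivative (gegenbauerOp a b q) = gegenbauerOp (a + 2) (a + b) (derivative q) := by
  simp only [gegenbauerOp, derivative_add, derivative_neg, derivative_mul, derivative_sub,
    derivative_one, derivative_X_pow, derivative_C, derivative_X, C_add]
  norm_num
  simp only [show (C 2 : ℝ[X]) = 2 from rfl]
  ring

/-! ### The perturbation series for the profile `h_κ` -/

open Polynomial in
/-- The coefficient of `κ` in the perturbation, `q ↦ (1 - X²) q' - X q`. -/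
def perturbOp (q : ℝ[X]) : ℝ[X] := (1 - X ^ 2) * derivative q - X * q

open Polynomial in
/-- The coefficients of the expansion of `h_κ` in powers of `κ`. -/
structure IsProfileSeq (N : ℝ) (p : ℕ → ℝ[X]) : Prop where
  zero : p 0 = C (N - 1)⁻¹
  one : p 1 = C (-(2 * N * (N - 1))⁻¹) * X
  succ : ∀ m, gegenbauerOp (N + 1) (N - 1) (p (m + 1)) = perturbOp (p m)

open Polynomial in
lemma exists_isProfileSeq {N : ℝ} (hN : 2 ≤ N) : ∃ p, IsProfileSeq N p := by
  choose S hS using gegenbauerOp_surjective (a := N + 1) (b := N - 1) (by linarith) (by linarith)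
  refine ⟨fun m => match m with
    | 0 => C (N - 1)⁻¹
    | m + 1 => (fun q => S (perturbOp q))^[m] (C (-(2 * N * (N - 1))⁻¹) * X), rfl, rfl, ?_⟩
  intro m
  cases m with
  | zero =>
    have h1 : N - 1 ≠ 0 := by linarith
    have h2 : N ≠ 0 := by linarith
    have h : (-(2 * N * (N - 1))⁻¹) * (N + 1 + (N - 1)) = -(N - 1)⁻¹ := by
      field_simp; ring
    have h' := congrArg (C : ℝ → ℝ[X]) h
    simp only [C_mul, C_add, C_sub, C_neg] at h'
    simp only [Function.iterate_zero, id_eq, gegenbauerOp, perturbOp, derivative_mul, derivative_C,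
      derivative_X, zero_mul, zero_add, mul_one, mul_zero, neg_zero, C_neg, C_add, C_sub,
      derivative_neg, zero_sub]
    linear_combination X * h'
  | succ m =>
    simp only [Function.iterate_succ_apply']
    exact hS _

open Polynomial in
-- The recursion and its first two derivatives are Gegenbauer equations with zero-order coefficients
-- `N - 1`, `2N` and `3N + 3`, to which the maximum principle applies. Control of two derivatives is
-- what allows the series to be differentiated twice up to `x = ±1`.
lemma IsProfileSeq.abs_eval_le {N : ℝ} (hN : 2 ≤ N) {p : ℕ → ℝ[X]} (hp : IsProfileSeq N p)
    (m : ℕ) : ∀ x ∈ Set.Icc (-1 : ℝ) 1, |(p m).eval x| ≤ 2 ^ m ∧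
      |(derivative (p m)).eval x| ≤ 2 ^ m ∧ |(derivative (derivative (p m))).eval x| ≤ 2 ^ m := by
  induction m using Nat.strong_induction_on with
  | _ m ih =>
    have hN1 : 0 < N - 1 := by linarith
    match m, ih with
    | 0, _ =>
      intro x _
      rw [hp.zero]
      simp only [derivative_C, eval_C, eval_zero, derivative_zero, abs_zero, pow_zero, zero_le_one,
        and_true]
      rw [abs_of_pos (by positivity)]
      exact inv_le_one_of_one_le₀ (by linarith)
    | 1, _ =>
      intro x hx
      have hc : |-(2 * N * (N - 1))⁻¹| ≤ 1 := by
        rw [abs_neg, abs_of_pos (by positivity)]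
        exact inv_le_one_of_one_le₀ (by nlinarith)
      rw [hp.one]
      simp only [derivative_mul, derivative_C, derivative_X, zero_mul, zero_add, mul_one, eval_mul,
        eval_C, eval_X, eval_zero, abs_zero, pow_one]
      refine ⟨?_, by linarith, by norm_num⟩
      rw [abs_mul]
      nlinarith [abs_le.2 hx, abs_nonneg x, abs_nonneg (-(2 * N * (N - 1))⁻¹)]
    | m + 2, ih =>
      have ih1 := ih (m + 1) (by omega)
      have ih0 := ih m (by omega)
      set q := p (m + 1) with hq
      set r := p m with hr
      set M : ℝ := 2 ^ m with hM
      have hM0 : 0 < M := by positivity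
      rw [pow_succ (2 : ℝ) m, ← hM] at ih1
      rw [show (2 : ℝ) ^ (m + 2) = M * 4 by rw [hM]; ring]
      have e0 : gegenbauerOp (N + 1) (N - 1) (p (m + 2)) = perturbOp q := hp.succ (m + 1)
      have e1 : gegenbauerOp (N + 1) (N - 1) q = perturbOp r := hp.succ m
      have hE (z A : ℝ) (h1 : |z| ≤ 1) (y B : ℝ) (hy : |y| ≤ B) (h : z * y = A) : |A| ≤ B := by
        rw [← h, abs_mul]; nlinarith [abs_nonneg y, abs_nonneg z]
      have b0 : ∀ x ∈ Set.Icc (-1 : ℝ) 1, |(perturbOp q).eval x| ≤ 4 * M := by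
        intro x hx
        obtain ⟨h1, h2, -⟩ := ih1 x hx
        have hx1 : |x| ≤ 1 := abs_le.2 hx
        have hx2 : |1 - x ^ 2| ≤ 1 := abs_le.2 ⟨by nlinarith [hx.1, hx.2], by nlinarith⟩
        simp only [perturbOp, eval_sub, eval_mul, eval_one, eval_pow, eval_X]
        have a1 := abs_le.1 (hE _ _ hx2 _ _ h2 rfl)
        have a2 := abs_le.1 (hE _ _ hx1 _ _ h1 rfl)
        exact abs_le.2 ⟨by linarith, by linarith⟩
      have d1 : ∀ u : ℝ[X], derivative (perturbOp u) =
          (1 - X ^ 2) * derivative (derivative u) - 3 * (X * derivative u) - u := by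
        intro u
        simp only [perturbOp, derivative_sub, derivative_mul, derivative_one, derivative_X_pow,
          derivative_X]
        norm_num
        simp only [show (C 2 : ℝ[X]) = 2 from rfl]
        ring
      have bd : ∀ (u : ℝ[X]) (B : ℝ), (∀ x ∈ Set.Icc (-1 : ℝ) 1, |u.eval x| ≤ B ∧
          |(derivative u).eval x| ≤ B ∧ |(derivative (derivative u)).eval x| ≤ B) →
          ∀ x ∈ Set.Icc (-1 : ℝ) 1, |(derivative (perturbOp u)).eval x| ≤ 5 * B := by
        intro u B hu x hx
        obtain ⟨h1, h2, h3⟩ := hu x hx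
        have hx1 : |x| ≤ 1 := abs_le.2 hx
        have hx2 : |1 - x ^ 2| ≤ 1 := abs_le.2 ⟨by nlinarith [hx.1, hx.2], by nlinarith⟩
        rw [d1]
        simp only [eval_sub, eval_mul, eval_one, eval_pow, eval_X, eval_ofNat]
        have a1 := abs_le.1 (hE _ _ hx2 _ _ h3 rfl)
        have a2 := abs_le.1 (hE _ _ hx1 _ _ h2 rfl)
        have a3 := abs_le.1 h1
        exact abs_le.2 ⟨by linarith, by linarith⟩
      have e1' : derivative (gegenbauerOp (N + 1) (N - 1) q) = derivative (perturbOp r) := by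
        rw [e1]
      rw [derivative_gegenbauerOp] at e1'
      -- Two derivatives of the right-hand side involve `q'''`, which is outside the induction
      -- hypothesis. The differentiated equation for `q` eliminates it, at the price of going back
      -- two steps to `r`. The resulting factor `N - 2` is absorbed by the coefficient `3N + 3`.
      have d2 : derivative (derivative (perturbOp q)) =
          C (N - 2) * (X * derivative (derivative q) + 2 * derivative q)
            - derivative (perturbOp r) := by
        rw [d1, ← e1']
        simp only [gegenbauerOp, derivative_sub, derivative_mul, derivative_one, derivative_X_pow,
          derivative_X, C_add, C_sub, C_1]
        norm_num
        simp only [show (C 2 : ℝ[X]) = 2 from rfl]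
        ring
      have bdd : ∀ x ∈ Set.Icc (-1 : ℝ) 1,
          |(derivative (derivative (perturbOp q))).eval x| ≤ 6 * (N - 2) * M + 5 * M := by
        intro x hx
        obtain ⟨h1, h2, h3⟩ := ih1 x hx
        have hx1 : |x| ≤ 1 := abs_le.2 hx
        rw [d2]
        simp only [eval_sub, eval_add, eval_mul, eval_C, eval_X, eval_ofNat]
        have a1 := abs_le.1 (bd r M ih0 x hx)
        have a2 := abs_le.1 (hE _ _ hx1 _ _ h3 rfl)
        have a3 := abs_le.1 h2
        have hN2 : 0 ≤ N - 2 := by linarith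
        have l1 := mul_le_mul_of_nonneg_left (show x * (derivative (derivative q)).eval x +
          2 * (derivative q).eval x ≤ 6 * M by linarith) hN2
        have l2 := mul_le_mul_of_nonneg_left (show -(6 * M) ≤
          x * (derivative (derivative q)).eval x + 2 * (derivative q).eval x by linarith) hN2
        exact abs_le.2 ⟨by linarith, by linarith⟩
      have f1 : derivative (gegenbauerOp (N + 1) (N - 1) (p (m + 2))) = derivative (perturbOp q) :=
        by rw [e0]
      rw [derivative_gegenbauerOp] at f1
      have f2 := congrArg derivative f1
      rw [derivative_gegenbauerOp] at f2
      intro x hx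
      refine ⟨?_, ?_, ?_⟩
      · refine (abs_eval_le_of_gegenbauerOp (a := N + 1) (by linarith) hN1 _ (M := 4 * M)
          (by rw [e0]; exact b0) x hx).trans ?_
        rw [div_le_iff₀ hN1]
        nlinarith
      · refine (abs_eval_le_of_gegenbauerOp (a := N + 1 + 2) (b := N + 1 + (N - 1))
          (by linarith) (by linarith) _ (M := 5 * (M * 2))
          (by rw [f1]; exact bd q _ ih1) x hx).trans ?_
        rw [div_le_iff₀ (by linarith)]
        nlinarith
      · refine (abs_eval_le_of_gegenbauerOp (a := N + 1 + 2 + 2)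
          (b := N + 1 + 2 + (N + 1 + (N - 1))) (by linarith) (by linarith) _
          (by rw [f2]; exact bdd) x hx).trans ?_
        rw [div_le_iff₀ (by linarith)]
        nlinarith

open Polynomial in
/-- The profile equation for `h_κ` has, for small `κ`, a solution which is twice differentiable
up to the boundary, and whose first-order expansion in `κ` is explicit. -/
theorem exists_profile {N κ : ℝ} (hN : 2 ≤ N) (hκ : 0 ≤ κ) (hκ' : κ ≤ 1 / 4) :
    ∃ H D E : ℝ → ℝ, ContinuousOn H (Set.Icc (-1) 1) ∧ ContinuousOn D (Set.Icc (-1) 1) ∧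
      ContinuousOn E (Set.Icc (-1) 1) ∧
      (∀ x ∈ Set.Ioo (-1 : ℝ) 1, HasDerivAt H (D x) x) ∧
      (∀ x ∈ Set.Ioo (-1 : ℝ) 1, HasDerivAt D (E x) x) ∧
      (∀ x ∈ Set.Icc (-1 : ℝ) 1, -((1 - x ^ 2) * E x) + ((N + 1) * x - κ * (1 - x ^ 2)) * D x +
        (N - 1 + κ * x) * H x = 1) ∧
      ∀ x ∈ Set.Icc (-1 : ℝ) 1, |H x - (N - 1)⁻¹ * (1 - κ * x / (2 * N))| ≤ 8 * κ ^ 2 := by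
  obtain ⟨p, hp⟩ := exists_isProfileSeq hN
  have hb := hp.abs_eval_le hN
  have hterm : ∀ (m : ℕ) (y : ℝ), |y| ≤ 2 ^ m → ‖κ ^ m * y‖ ≤ (1 / 2 : ℝ) ^ m := by
    intro m y hy
    rw [Real.norm_eq_abs, abs_mul, abs_of_nonneg (by positivity)]
    calc κ ^ m * |y| ≤ (1 / 4) ^ m * 2 ^ m := by gcongr
      _ = (1 / 2 : ℝ) ^ m := by rw [← mul_pow]; norm_num
  have hu : Summable fun m : ℕ => (1 / 2 : ℝ) ^ m := summable_geometric_two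
  have hsub : Set.Ioo (-1 : ℝ) 1 ⊆ Set.Icc (-1) 1 := Set.Ioo_subset_Icc_self
  have hsum : ∀ f : ℕ → ℝ, (∀ m, |f m| ≤ 2 ^ m) → Summable fun m => κ ^ m * f m := fun f hf =>
    Summable.of_norm_bounded hu fun m => hterm m _ (hf m)
  refine ⟨fun x => ∑' m, κ ^ m * (p m).eval x, fun x => ∑' m, κ ^ m * (derivative (p m)).eval x,
    fun x => ∑' m, κ ^ m * (derivative (derivative (p m))).eval x, ?_, ?_, ?_, ?_, ?_, ?_, ?_⟩
  · exact continuousOn_tsum (fun m => (continuous_const.mul (p m).continuous).continuousOn) hu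
      fun m x hx => hterm m _ (hb m x hx).1
  · exact continuousOn_tsum (fun m => (continuous_const.mul (Polynomial.continuous _)).continuousOn)
      hu fun m x hx => hterm m _ (hb m x hx).2.1
  · exact continuousOn_tsum (fun m => (continuous_const.mul (Polynomial.continuous _)).continuousOn)
      hu fun m x hx => hterm m _ (hb m x hx).2.2
  · intro x hx
    exact hasDerivAt_tsum_of_isPreconnected hu isOpen_Ioo isPreconnected_Ioo
      (fun m y _ => ((p m).hasDerivAt y).const_mul _)
      (fun m y hy => hterm m _ (hb m y (hsub hy)).2.1) hx
      (hsum _ fun m => (hb m x (hsub hx)).1) hx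
  · intro x hx
    exact hasDerivAt_tsum_of_isPreconnected hu isOpen_Ioo isPreconnected_Ioo
      (fun m y _ => ((derivative (p m)).hasDerivAt y).const_mul _)
      (fun m y hy => hterm m _ (hb m y (hsub hy)).2.2) hx
      (hsum _ fun m => (hb m x (hsub hx)).2.1) hx
  · intro x hx
    have sH := hsum _ fun m => (hb m x hx).1
    have sD := hsum _ fun m => (hb m x hx).2.1
    have sE := hsum _ fun m => (hb m x hx).2.2
    have hT := (((sE.hasSum.mul_left (1 - x ^ 2)).neg.add
      (sD.hasSum.mul_left ((N + 1) * x))).add (sH.hasSum.mul_left (N - 1)))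
    have hR := ((sD.hasSum.mul_left (1 - x ^ 2)).sub (sH.hasSum.mul_left x)).mul_left κ
    -- The unperturbed operator at order `m + 1` balances the perturbation at order `m`. Only the
    -- order-zero term survives, and it equals `1`.
    have hstep : ∀ m, -((1 - x ^ 2) * (κ ^ (m + 1) * (derivative (derivative (p (m + 1)))).eval x))
        + (N + 1) * x * (κ ^ (m + 1) * (derivative (p (m + 1))).eval x)
        + (N - 1) * (κ ^ (m + 1) * (p (m + 1)).eval x) =
        κ * ((1 - x ^ 2) * (κ ^ m * (derivative (p m)).eval x) - x * (κ ^ m * (p m).eval x)) := by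
      intro m
      have := congrArg (eval x) (hp.succ m)
      simp only [gegenbauerOp, perturbOp, eval_add, eval_neg, eval_mul, eval_sub, eval_one,
        eval_pow, eval_X, eval_C] at this
      rw [pow_succ]
      linear_combination (κ ^ m * κ) * this
    have h0 := hT.summable.hasSum
    rw [hT.summable.tsum_eq_zero_add] at h0
    simp only [hstep] at h0
    rw [hR.tsum_eq] at h0
    have := hT.unique h0
    rw [hp.zero] at this
    have hN1 : (N - 1) * (N - 1)⁻¹ = 1 := mul_inv_cancel₀ (by linarith)
    simp only [derivative_C, derivative_zero, eval_zero, eval_C, mul_zero, neg_zero, pow_zero,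
      one_mul, zero_add] at this
    linear_combination this + hN1
  · intro x hx
    have sH := hsum _ fun m => (hb m x hx).1
    have h2 := sH.sum_add_tsum_nat_add 2
    have e : (∑ m ∈ Finset.range 2, κ ^ m * (p m).eval x) =
        (N - 1)⁻¹ * (1 - κ * x / (2 * N)) := by
      rw [Finset.sum_range_succ, Finset.sum_range_one, hp.zero, hp.one]
      simp only [eval_C, eval_mul, eval_X]
      have h1 : N - 1 ≠ 0 := by linarith
      have h2 : N ≠ 0 := by linarith
      field_simp
      ring
    simp only []
    rw [← h2, e, add_sub_cancel_left, ← Real.norm_eq_abs]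
    -- The tail from order two has terms at most `κ ^ (m + 2) 2 ^ (m + 2) ≤ 4 κ² 2⁻ᵐ`; this is the
    -- source of the constant `8`.
    have hg : HasSum (fun m : ℕ => 4 * κ ^ 2 * (1 / 2 : ℝ) ^ m) (4 * κ ^ 2 * 2) :=
      hasSum_geometric_two.mul_left _
    refine (tsum_of_norm_bounded hg fun m => ?_).trans (by linarith)
    have h4 := hterm m ((p (m + 2)).eval x / 4) (by
      rw [abs_div, abs_of_pos (by norm_num : (0 : ℝ) < 4), div_le_iff₀ (by norm_num)]
      refine (hb (m + 2) x hx).1.trans (le_of_eq (by ring)))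
    have : κ ^ (m + 2) * (p (m + 2)).eval x =
        4 * κ ^ 2 * (κ ^ m * ((p (m + 2)).eval x / 4)) := by ring
    rw [this, norm_mul, Real.norm_of_nonneg (by positivity)]
    gcongr

/-! ### Existence of the generalized collisional invariant for small `κ` -/

lemma cos_mem_Ioo {θ : ℝ} (hθ : θ ∈ Set.Ioo 0 π) : Real.cos θ ∈ Set.Ioo (-1 : ℝ) 1 := by
  have hp := Real.pi_pos
  have h1 := Real.strictAntiOn_cos ⟨le_rfl, hp.le⟩ ⟨hθ.1.le, hθ.2.le⟩ hθ.1
  have h2 := Real.strictAntiOn_cos ⟨hθ.1.le, hθ.2.le⟩ ⟨hp.le, le_rfl⟩ hθ.2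
  rw [Real.cos_zero] at h1
  rw [Real.cos_pi] at h2
  exact ⟨h2, h1⟩

lemma memLp_two_Ioo_of_continuous {f : ℝ → ℝ} (hf : Continuous f) :
    MeasureTheory.MemLp f 2 (MeasureTheory.volume.restrict (Set.Ioo 0 π)) := by
  obtain ⟨C, hC⟩ := isCompact_Icc.exists_bound_of_continuousOn (s := Set.Icc 0 π) hf.continuousOn
  refine MeasureTheory.MemLp.of_bound hf.aestronglyMeasurable C ?_
  exact (MeasureTheory.ae_restrict_iff' measurableSet_Ioo).2
    (Filter.Eventually.of_forall fun x hx => hC x (Set.Ioo_subset_Icc_self hx))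

lemma contDiffOn_two_of_hasDerivAt {s : Set ℝ} (hs : IsOpen s) {H D E : ℝ → ℝ}
    (hH : ∀ x ∈ s, HasDerivAt H (D x) x) (hD : ∀ x ∈ s, HasDerivAt D (E x) x)
    (hE : ContinuousOn E s) : ContDiffOn ℝ 2 H s := by
  have h1 : ContDiffOn ℝ 1 D s := by
    have := (contDiffOn_succ_iff_deriv_of_isOpen (n := 0) (𝕜 := ℝ) (f := D) hs).2
      ⟨fun x hx => (hD x hx).differentiableAt.differentiableWithinAt, by simp,
        contDiffOn_zero.2 (hE.congr fun x hx => (hD x hx).deriv)⟩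
    simpa using this
  have := (contDiffOn_succ_iff_deriv_of_isOpen (n := 1) (𝕜 := ℝ) (f := H) hs).2
      ⟨fun x hx => (hH x hx).differentiableAt.differentiableWithinAt, by simp,
        h1.congr fun x hx => (hH x hx).deriv⟩
  rwa [one_add_one_eq_two] at this

/-- The substitution `g = sin θ · H(cos θ)` turns the profile equation into the equation for `g_κ`.
Continuity of `H` and `D` up to `±1` and the extra factor `sin θ` supply membership in `V`. -/
theorem isGCISolution_of_profile {n : ℕ} (hn : 2 ≤ n) {κ : ℝ} {H D E : ℝ → ℝ}
    (cH : ContinuousOn H (Set.Icc (-1) 1)) (cD : ContinuousOn D (Set.Icc (-1) 1))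
    (cE : ContinuousOn E (Set.Icc (-1) 1))
    (dH : ∀ x ∈ Set.Ioo (-1 : ℝ) 1, HasDerivAt H (D x) x)
    (dD : ∀ x ∈ Set.Ioo (-1 : ℝ) 1, HasDerivAt D (E x) x)
    (ode : ∀ x ∈ Set.Icc (-1 : ℝ) 1, -((1 - x ^ 2) * E x) +
      (((n : ℝ) + 1) * x - κ * (1 - x ^ 2)) * D x + ((n : ℝ) - 1 + κ * x) * H x = 1) :
    IsGCISolution n κ fun θ => Real.sin θ * H (Real.cos θ) := by
  have hcos : ∀ θ : ℝ, Real.cos θ ∈ Set.Icc (-1 : ℝ) 1 := fun θ =>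
    ⟨Real.neg_one_le_cos θ, Real.cos_le_one θ⟩
  have cH' : Continuous fun θ => H (Real.cos θ) := cH.comp_continuous Real.continuous_cos hcos
  have cD' : Continuous fun θ => D (Real.cos θ) := cD.comp_continuous Real.continuous_cos hcos
  have dH' : ∀ θ ∈ Set.Ioo 0 π, HasDerivAt (fun t => H (Real.cos t))
      (D (Real.cos θ) * -Real.sin θ) θ := fun θ hθ =>
    (dH _ (cos_mem_Ioo hθ)).comp θ (Real.hasDerivAt_cos θ)
  have dD' : ∀ θ ∈ Set.Ioo 0 π, HasDerivAt (fun t => D (Real.cos t))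
      (E (Real.cos θ) * -Real.sin θ) θ := fun θ hθ =>
    (dD _ (cos_mem_Ioo hθ)).comp θ (Real.hasDerivAt_cos θ)
  have hn2 : (2 : ℝ) ≤ n := by exact_mod_cast hn
  refine ⟨?_, ?_, ?_, ?_⟩
  · exact Real.contDiff_sin.contDiffOn.mul ((contDiffOn_two_of_hasDerivAt isOpen_Ioo dH dD
      (cE.mono Set.Ioo_subset_Icc_self)).comp Real.contDiff_cos.contDiffOn
        fun θ hθ => cos_mem_Ioo hθ)
  · intro θ hθ
    have hs : 0 < Real.sin θ := Real.sin_pos_of_mem_Ioo hθ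
    have hg : ∀ t ∈ Set.Ioo 0 π, deriv (fun θ => Real.sin θ * H (Real.cos θ)) t =
        Real.cos t * H (Real.cos t) - Real.sin t ^ 2 * D (Real.cos t) := by
      intro t ht
      rw [((Real.hasDerivAt_sin t).fun_mul (dH' t ht)).deriv]
      ring
    obtain ⟨m, rfl⟩ : ∃ m, n = m + 2 := ⟨n - 2, by omega⟩
    have hW : (fun t => Real.sin t ^ (m + 2 - 2) * Real.exp (κ * Real.cos t) *
        deriv (fun θ => Real.sin θ * H (Real.cos θ)) t) =ᶠ[𝓝 θ] fun t =>
        Real.sin t ^ m * Real.exp (κ * Real.cos t) *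
          (Real.cos t * H (Real.cos t) - Real.sin t ^ 2 * D (Real.cos t)) := by
      filter_upwards [isOpen_Ioo.mem_nhds hθ] with t ht
      rw [hg t ht, Nat.add_sub_cancel]
    have hder := (((Real.hasDerivAt_sin θ).fun_pow m).fun_mul
      ((Real.hasDerivAt_cos θ).const_mul κ).exp).fun_mul
      (((Real.hasDerivAt_cos θ).fun_mul (dH' θ hθ)).fun_sub
        (((Real.hasDerivAt_sin θ).fun_pow 2).fun_mul (dD' θ hθ)))
    rw [hW.deriv_eq, hder.deriv]
    -- The truncated exponent at `m = 0` is harmless because of the factor `m`.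
    have hpow : (m : ℝ) * Real.sin θ ^ (m - 1) = m * Real.sin θ ^ m / Real.sin θ := by
      cases m with
      | zero => simp
      | succ m => rw [Nat.add_sub_cancel, pow_succ]; field_simp
    have ho := ode _ (hcos θ)
    have hsc := Real.sin_sq_add_cos_sq θ
    rw [hpow, Real.exp_neg]
    have he := Real.exp_pos (κ * Real.cos θ)
    have hsm : 0 < Real.sin θ ^ m := by positivity
    push_cast at ho ⊢
    generalize Real.exp (κ * Real.cos θ) = e at *
    generalize H (Real.cos θ) = h at *
    generalize D (Real.cos θ) = d at *
    generalize E (Real.cos θ) = e2 at *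
    generalize Real.sin θ ^ m = sm at *
    generalize Real.sin θ = s at *
    generalize Real.cos θ = c at *
    field_simp
    norm_num
    have hc : c ^ 2 = 1 - s ^ 2 := by linarith
    rw [show (1 : ℝ) - c ^ 2 = s ^ 2 by linarith] at ho
    linear_combination s ^ 2 * ho - (m : ℝ) * h * hc
  · have hc : Continuous fun θ => ((n : ℝ) - 2) * Real.sin θ ^ ((n : ℝ) / 2 - 1) *
        H (Real.cos θ) :=
      (continuous_const.mul (Real.continuous_sin.rpow_const fun _ => Or.inr (by linarith))).mul cH'
    refine (memLp_two_Ioo_of_continuous hc).ae_eq ?_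
    refine (MeasureTheory.ae_restrict_iff' measurableSet_Ioo).2
      (Filter.Eventually.of_forall fun θ hθ => ?_)
    have hs : 0 < Real.sin θ := Real.sin_pos_of_mem_Ioo hθ
    simp only []
    rw [show (n : ℝ) / 2 - 1 = n / 2 - 2 + 1 by ring, Real.rpow_add_one hs.ne']
    ring
  · have cU : Continuous fun θ => Real.sin θ ^ ((n : ℝ) / 2) * H (Real.cos θ) :=
      (Real.continuous_sin.rpow_const fun _ => Or.inr (by linarith)).mul cH'
    have cV : Continuous fun θ => (n : ℝ) / 2 * Real.sin θ ^ ((n : ℝ) / 2 - 1) * Real.cos θ *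
        H (Real.cos θ) - Real.sin θ ^ ((n : ℝ) / 2) * (D (Real.cos θ) * Real.sin θ) := by
      have h1 : Continuous fun θ => Real.sin θ ^ ((n : ℝ) / 2 - 1) :=
        Real.continuous_sin.rpow_const fun _ => Or.inr (by linarith)
      have h2 : Continuous fun θ => Real.sin θ ^ ((n : ℝ) / 2) :=
        Real.continuous_sin.rpow_const fun _ => Or.inr (by linarith)
      exact (((continuous_const.mul h1).mul Real.continuous_cos).mul cH').sub
        (h2.mul (cD'.mul Real.continuous_sin))
    have hint : ∀ x ∈ Set.Icc 0 π, ∫ t in (0 : ℝ)..x, ((n : ℝ) / 2 *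
        Real.sin t ^ ((n : ℝ) / 2 - 1) * Real.cos t *
        H (Real.cos t) - Real.sin t ^ ((n : ℝ) / 2) * (D (Real.cos t) * Real.sin t)) =
        Real.sin x ^ ((n : ℝ) / 2) * H (Real.cos x) := by
      intro x hx
      rw [intervalIntegral.integral_eq_sub_of_hasDerivAt_of_le hx.1 cU.continuousOn
        (fun t ht => ?_) (cV.intervalIntegrable _ _), Real.sin_zero,
        Real.zero_rpow (by linarith), zero_mul, sub_zero]
      have ht' : t ∈ Set.Ioo 0 π := ⟨ht.1, ht.2.trans_le hx.2⟩
      have hs : 0 < Real.sin t := Real.sin_pos_of_mem_Ioo ht'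
      exact (((Real.hasDerivAt_sin t).rpow_const (p := (n : ℝ) / 2) (Or.inl hs.ne')).mul
        (dH' t ht')).congr_deriv (by ring)
    refine ⟨_, memLp_two_Ioo_of_continuous cV, fun x hx => ?_, ?_⟩
    · rw [hint x (Set.Ioo_subset_Icc_self hx)]
      have hs : 0 < Real.sin x := Real.sin_pos_of_mem_Ioo hx
      rw [show (n : ℝ) / 2 = n / 2 - 1 + 1 by ring, Real.rpow_add_one hs.ne']
      ring_nf
    · rw [hint π ⟨Real.pi_pos.le, le_rfl⟩, Real.sin_pi, Real.zero_rpow (by linarith), zero_mul]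

/-! ### Uniqueness of the generalized collisional invariant -/

open MeasureTheory

lemma intervalIntegrable_of_memLp_two {v : ℝ → ℝ}
    (hv : MemLp v 2 (volume.restrict (Set.Ioo 0 π))) : IntervalIntegrable v volume 0 π := by
  rw [intervalIntegrable_iff_integrableOn_Ioo_of_le Real.pi_pos.le]
  exact hv.integrable (by norm_num)

lemma MemH10.sub {u₁ u₂ : ℝ → ℝ} (h₁ : MemH10 u₁) (h₂ : MemH10 u₂) :
    MemH10 fun x => u₁ x - u₂ x := by
  obtain ⟨v₁, hv₁, hu₁, hi₁⟩ := h₁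
  obtain ⟨v₂, hv₂, hu₂, hi₂⟩ := h₂
  have i₁ := intervalIntegrable_of_memLp_two hv₁
  have i₂ := intervalIntegrable_of_memLp_two hv₂
  refine ⟨fun x => v₁ x - v₂ x, hv₁.sub hv₂, fun x hx => ?_, ?_⟩
  · have hs : Set.uIcc 0 x ⊆ Set.uIcc 0 π :=
      Set.uIcc_subset_uIcc_left (Set.mem_uIcc.2 (Or.inl ⟨hx.1.le, hx.2.le⟩))
    rw [intervalIntegral.integral_sub (i₁.mono_set hs) (i₂.mono_set hs), ← hu₁ x hx, ← hu₂ x hx]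
  · rw [intervalIntegral.integral_sub i₁ i₂, hi₁, hi₂, sub_zero]

lemma MemH10.tendsto {u : ℝ → ℝ} (h : MemH10 u) :
    Filter.Tendsto u (𝓝[>] 0) (𝓝 0) ∧ Filter.Tendsto u (𝓝[<] π) (𝓝 0) := by
  obtain ⟨v, hv, hu, hi⟩ := h
  have hp := Real.pi_pos
  have i := intervalIntegrable_of_memLp_two hv
  have hc : ContinuousOn (fun x => ∫ t in (0 : ℝ)..x, v t) (Set.Icc 0 π) := by
    have := intervalIntegral.continuousOn_primitive_interval' i
      (Set.left_mem_uIcc)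
    rwa [Set.uIcc_of_le hp.le] at this
  constructor
  · have h0 := (hc 0 ⟨le_rfl, hp.le⟩).mono_left
      (nhdsWithin_mono (0 : ℝ) Set.Ioo_subset_Icc_self)
    simp only [intervalIntegral.integral_same] at h0
    rw [nhdsWithin_Ioo_eq_nhdsGT hp] at h0
    refine h0.congr' ?_
    filter_upwards [Ioo_mem_nhdsGT hp] with x hx using (hu x hx).symm
  · have h0 := (hc π ⟨hp.le, le_rfl⟩).mono_left
      (nhdsWithin_mono π Set.Ioo_subset_Icc_self)
    simp only [hi] at h0
    rw [nhdsWithin_Ioo_eq_nhdsLT hp] at h0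
    refine h0.congr' ?_
    filter_upwards [Ioo_mem_nhdsLT hp] with x hx using (hu x hx).symm

/-- By Lebesgue differentiation the classical derivative agrees almost everywhere with the `L²`
density of `u`. -/
lemma MemH10.memLp_deriv {u u' : ℝ → ℝ} (h : MemH10 u)
    (hd : ∀ x ∈ Set.Ioo 0 π, HasDerivAt u (u' x) x) :
    MemLp u' 2 (volume.restrict (Set.Ioo 0 π)) := by
  obtain ⟨v, hv, hu, -⟩ := h
  have i := intervalIntegrable_of_memLp_two hv
  refine hv.ae_eq ?_
  refine (ae_restrict_iff' measurableSet_Ioo).2 ?_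
  filter_upwards [i.ae_hasDerivAt_integral] with x hx hx'
  have hx1 := hx (by rw [Set.uIcc_of_le Real.pi_pos.le]; exact Set.Ioo_subset_Icc_self hx') 0
    Set.left_mem_uIcc
  refine (hx1.congr_of_eventuallyEq ?_).unique (hd x hx')
  filter_upwards [isOpen_Ioo.mem_nhds hx'] with y hy using hu y hy

/-- The equation in divergence form. -/
lemma IsGCISolution.hasDerivAt_flux {m : ℕ} {κ : ℝ} {g : ℝ → ℝ}
    (h : IsGCISolution (m + 2) κ g) {θ : ℝ} (hθ : θ ∈ Set.Ioo 0 π) :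
    HasDerivAt g (deriv g θ) θ ∧
    HasDerivAt (fun t => Real.sin t ^ m * Real.exp (κ * Real.cos t) * deriv g t)
      (Real.sin θ ^ m * Real.exp (κ * Real.cos θ) * (m * g θ / Real.sin θ ^ 2 - Real.sin θ)) θ := by
  have hd : DifferentiableOn ℝ (deriv g) (Set.Ioo 0 π) := by
    have := h.contDiffOn
    rw [← one_add_one_eq_two, contDiffOn_succ_iff_deriv_of_isOpen isOpen_Ioo] at this
    exact this.2.2.differentiableOn (by norm_num)
  have hg : DifferentiableOn ℝ g (Set.Ioo 0 π) := h.contDiffOn.differentiableOn (by norm_num)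
  have hn := isOpen_Ioo.mem_nhds hθ
  refine ⟨(hg.differentiableAt hn).hasDerivAt, ?_⟩
  have hD : DifferentiableAt ℝ
      (fun t => Real.sin t ^ m * Real.exp (κ * Real.cos t) * deriv g t) θ := by
    have := hd.differentiableAt hn
    fun_prop
  refine hD.hasDerivAt.congr_deriv ?_
  have he := h.equation θ hθ
  have hs : 0 < Real.sin θ := Real.sin_pos_of_mem_Ioo hθ
  have hE := Real.exp_pos (κ * Real.cos θ)
  rw [Real.exp_neg] at he
  push_cast at he
  simp only [add_sub_cancel_right] at he
  have hne : Real.sin θ ^ m ≠ 0 := by positivity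
  generalize deriv (fun t => Real.sin t ^ m * Real.exp (κ * Real.cos t) * deriv g t) θ = X at *
  have : (m : ℝ) * g θ / Real.sin θ ^ 2 - Real.sin θ =
      (Real.sin θ ^ m)⁻¹ * (Real.exp (κ * Real.cos θ))⁻¹ * X := by
    linear_combination he
  rw [this]
  field_simp

lemma not_integrable_of_le_left {f : ℝ → ℝ} (hf : IntegrableOn f (Set.Ioo 0 π)) {a δ : ℝ}
    (ha : a ∈ Set.Ioo 0 π) (hδ : 0 < δ) (h : ∀ x ∈ Set.Ioo 0 a, δ / x ≤ |f x|) : False := by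
  have hI : IntervalIntegrable (fun x : ℝ => (x - 0)⁻¹) volume 0 a := by
    rw [intervalIntegrable_iff_integrableOn_Ioo_of_le ha.1.le]
    have h1 : IntegrableOn (fun x => δ⁻¹ * |f x|) (Set.Ioo 0 a) :=
      ((hf.mono_set (Set.Ioo_subset_Ioo_right ha.2.le)).abs).const_mul _
    refine Integrable.mono' h1 (by fun_prop) ?_
    refine (ae_restrict_iff' measurableSet_Ioo).2 (Filter.Eventually.of_forall fun x hx => ?_)
    have := h x hx
    rw [sub_zero, norm_inv, Real.norm_of_nonneg hx.1.le, ← div_eq_inv_mul, le_div_iff₀ hδ]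
    rwa [← div_eq_inv_mul]
  rw [intervalIntegrable_sub_inv_iff] at hI
  rcases hI with hI | hI
  · exact ha.1.ne hI
  · exact hI Set.left_mem_uIcc

lemma not_integrable_of_le_right {f : ℝ → ℝ} (hf : IntegrableOn f (Set.Ioo 0 π)) {a δ : ℝ}
    (ha : a ∈ Set.Ioo 0 π) (hδ : 0 < δ) (h : ∀ x ∈ Set.Ioo a π, δ / (π - x) ≤ |f x|) : False := by
  have hI : IntervalIntegrable (fun x : ℝ => (x - π)⁻¹) volume a π := by
    rw [intervalIntegrable_iff_integrableOn_Ioo_of_le ha.2.le]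
    have h1 : IntegrableOn (fun x => δ⁻¹ * |f x|) (Set.Ioo a π) :=
      ((hf.mono_set (Set.Ioo_subset_Ioo_left ha.1.le)).abs).const_mul _
    refine Integrable.mono' h1 (by fun_prop) ?_
    refine (ae_restrict_iff' measurableSet_Ioo).2 (Filter.Eventually.of_forall fun x hx => ?_)
    have := h x hx
    rw [norm_inv, Real.norm_eq_abs, abs_sub_comm, abs_of_pos (sub_pos.2 hx.2), ← div_eq_inv_mul,
      le_div_iff₀ hδ]
    rwa [← div_eq_inv_mul]
  rw [intervalIntegrable_sub_inv_iff] at hI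
  rcases hI with hI | hI
  · exact ha.2.ne hI
  · exact hI Set.right_mem_uIcc

/-- The homogeneous problem has only the trivial solution. -/
lemma eq_zero_of_homogeneous {m : ℕ} {κ : ℝ} {d d' : ℝ → ℝ}
    (hd : ∀ θ ∈ Set.Ioo 0 π, HasDerivAt d (d' θ) θ)
    (hflux : ∀ θ ∈ Set.Ioo 0 π,
      HasDerivAt (fun t => Real.sin t ^ m * Real.exp (κ * Real.cos t) * d' t)
        (Real.sin θ ^ m * Real.exp (κ * Real.cos θ) * (m * d θ / Real.sin θ ^ 2)) θ)
    (hL2 : MemLp (fun θ => (m : ℝ) * Real.sin θ ^ ((m : ℝ) / 2 - 1) * d θ) 2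
      (volume.restrict (Set.Ioo 0 π)))
    (hH : MemH10 fun θ => Real.sin θ ^ ((m : ℝ) / 2) * d θ) :
    ∀ θ ∈ Set.Ioo 0 π, d θ = 0 := by
  have hp := Real.pi_pos
  have hsin : ∀ θ ∈ Set.Ioo 0 π, 0 < Real.sin θ := fun θ hθ => Real.sin_pos_of_mem_Ioo hθ
  rcases Nat.eq_zero_or_pos m with rfl | hm
  -- In dimension two the zero-order term disappears and the flux is constant. Rolle's theorem,
  -- applied with the zero boundary limits, makes it vanish.
  · simp only [Nat.cast_zero, zero_div, Real.rpow_zero, one_mul] at hH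
    obtain ⟨l0, lp⟩ := hH.tendsto
    simp only [pow_zero, one_mul, Nat.cast_zero, zero_mul, zero_div, mul_zero] at hflux
    obtain ⟨c, hc, hc0⟩ := exists_hasDerivAt_eq_zero' hp l0 lp hd
    have hd'0 : ∀ θ ∈ Set.Ioo 0 π, d' θ = 0 := by
      intro θ hθ
      have := isOpen_Ioo.is_const_of_deriv_eq_zero isPreconnected_Ioo
        (fun x hx => (hflux x hx).differentiableAt.differentiableWithinAt)
        (fun x hx => (hflux x hx).deriv) hθ hc
      simp only [hc0, mul_zero] at this
      exact (mul_eq_zero.1 this).resolve_left (Real.exp_pos _).ne'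
    intro θ hθ
    have hconst : ∀ x ∈ Set.Ioo 0 π, d x = d θ := fun x hx =>
      isOpen_Ioo.is_const_of_deriv_eq_zero isPreconnected_Ioo
        (fun x hx => (hd x hx).differentiableAt.differentiableWithinAt)
        (fun x hx => (hd x hx).deriv.trans (hd'0 x hx)) hx hθ
    have : Filter.Tendsto d (𝓝[>] 0) (𝓝 (d θ)) := by
      refine tendsto_const_nhds.congr' ?_
      filter_upwards [Ioo_mem_nhdsGT hp] with x hx using (hconst x hx).symm
    exact tendsto_nhds_unique this l0
  -- Energy argument: `Φ` is the boundary term of the integration by parts against `d`, and `Φ'` is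
  -- the nonnegative energy density. Instead of computing limits at the endpoints, monotonicity is
  -- played against integrability of `Φ / sin`: a nonzero value of `Φ` would persist up to one
  -- endpoint and force a divergence like `1/x` there.
  · set Φ : ℝ → ℝ := fun t => Real.sin t ^ m * Real.exp (κ * Real.cos t) * d' t * d t with hΦ
    have dΦ : ∀ θ ∈ Set.Ioo 0 π, HasDerivAt Φ (Real.sin θ ^ m * Real.exp (κ * Real.cos θ) *
        (m * d θ ^ 2 / Real.sin θ ^ 2 + d' θ ^ 2)) θ := by
      intro θ hθ
      exact ((hflux θ hθ).fun_mul (hd θ hθ)).congr_deriv (by ring)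
    have hmono : MonotoneOn Φ (Set.Ioo 0 π) := by
      refine monotoneOn_of_deriv_nonneg (convex_Ioo _ _)
        (fun x hx => (dΦ x hx).continuousAt.continuousWithinAt) ?_ ?_
      · rw [interior_Ioo]
        exact fun x hx => (dΦ x hx).differentiableAt.differentiableWithinAt
      · rw [interior_Ioo]
        intro x hx
        have := hsin x hx
        rw [(dΦ x hx).deriv]
        positivity
    have hm' : (m : ℝ) ≠ 0 := by positivity
    -- With `u = sin^(m/2) d`, the two conditions defining `V` put `u'` and `sin^(m/2 - 1) d` in
    -- `L²`. Subtracting the part of `u'` that comes from differentiating the weight leaves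
    -- `sin^(m/2) d'`, and `Φ / sin` is a bounded factor times a product of `L²` functions.
    have hint : IntegrableOn (fun θ => Φ θ / Real.sin θ) (Set.Ioo 0 π) := by
      have hu := hH.memLp_deriv fun θ hθ =>
        ((Real.hasDerivAt_sin θ).rpow_const (p := (m : ℝ) / 2)
          (Or.inl (hsin θ hθ).ne')).fun_mul (hd θ hθ)
      have i1 := hL2.integrable_mul hu
      have i2 := hL2.integrable_mul hL2
      have i3 := i2.bdd_mul (f := fun θ => Real.cos θ / 2) (c := 1) (by fun_prop)
        (Filter.Eventually.of_forall fun θ => by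
          rw [Real.norm_eq_abs, abs_div, abs_two]
          have := Real.abs_cos_le_one θ
          linarith)
      have i4 := ((i1.sub i3).bdd_mul (f := fun θ => (m : ℝ)⁻¹ * Real.exp (κ * Real.cos θ))
        (c := (m : ℝ)⁻¹ * Real.exp |κ|) (by fun_prop) (Filter.Eventually.of_forall fun θ => by
          rw [norm_mul, norm_inv, Real.norm_natCast, Real.norm_of_nonneg (Real.exp_pos _).le]
          gcongr
          refine (le_abs_self _).trans ?_
          rw [abs_mul]
          exact mul_le_of_le_one_right (abs_nonneg _) (Real.abs_cos_le_one θ)))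
      refine i4.congr ?_
      refine (ae_restrict_iff' measurableSet_Ioo).2 (Filter.Eventually.of_forall fun θ hθ => ?_)
      have hs := hsin θ hθ
      simp only [Pi.sub_apply, Pi.mul_apply, hΦ]
      have e1 : Real.sin θ ^ ((m : ℝ) / 2) = Real.sin θ ^ ((m : ℝ) / 2 - 1) * Real.sin θ := by
        rw [← Real.rpow_add_one hs.ne']; ring_nf
      have e2 : Real.sin θ ^ m =
          (Real.sin θ ^ ((m : ℝ) / 2 - 1) * Real.sin θ) * (Real.sin θ ^ ((m : ℝ) / 2 - 1) *
            Real.sin θ) := by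
        rw [← e1, ← Real.rpow_add hs, ← Real.rpow_natCast]; ring_nf
      rw [e1, e2]
      field_simp
      ring
    have hzero : ∀ θ ∈ Set.Ioo 0 π, Φ θ = 0 := by
      intro a ha
      by_contra hne
      rcases lt_or_gt_of_ne hne with hneg | hpos
      · refine not_integrable_of_le_left hint ha (δ := -Φ a) (by linarith) fun x hx => ?_
        have hx' : x ∈ Set.Ioo 0 π := ⟨hx.1, hx.2.trans ha.2⟩
        have hs := hsin x hx'
        have h1 := hmono hx' ha hx.2.le
        rw [abs_div, abs_of_pos hs, abs_of_neg (by linarith)]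
        exact div_le_div₀ (by linarith) (by linarith) hs (Real.sin_le hx.1.le)
      · refine not_integrable_of_le_right hint ha (δ := Φ a) hpos fun x hx => ?_
        have hx' : x ∈ Set.Ioo 0 π := ⟨ha.1.trans hx.1, hx.2⟩
        have hs := hsin x hx'
        have h1 := hmono ha hx' hx.1.le
        rw [abs_div, abs_of_pos hs, abs_of_pos (by linarith)]
        refine div_le_div₀ (by linarith) (by linarith) hs ?_
        rw [← Real.sin_pi_sub]
        exact Real.sin_le (by linarith [hx.2])
    intro θ hθ
    have hs := hsin θ hθ
    have h0 : HasDerivAt Φ 0 θ := by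
      refine (hasDerivAt_const θ (0 : ℝ)).congr_of_eventuallyEq ?_
      filter_upwards [isOpen_Ioo.mem_nhds hθ] with x hx using hzero x hx
    have h1 := (dΦ θ hθ).unique h0
    have h2 : (m : ℝ) * d θ ^ 2 / Real.sin θ ^ 2 + d' θ ^ 2 = 0 :=
      (mul_eq_zero.1 h1).resolve_left (by positivity)
    have h3 : (m : ℝ) * d θ ^ 2 / Real.sin θ ^ 2 = 0 := by
      have : 0 ≤ (m : ℝ) * d θ ^ 2 / Real.sin θ ^ 2 := by positivity
      nlinarith [sq_nonneg (d' θ)]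
    have h4 : d θ ^ 2 = 0 := by
      rcases div_eq_zero_iff.1 h3 with h | h
      · exact (mul_eq_zero.1 h).resolve_left hm'
      · exact absurd h (by positivity)
    exact pow_eq_zero_iff (two_ne_zero) |>.1 h4

theorem IsGCISolution.eqOn {n : ℕ} (hn : 2 ≤ n) {κ : ℝ} {g₁ g₂ : ℝ → ℝ}
    (h₁ : IsGCISolution n κ g₁) (h₂ : IsGCISolution n κ g₂) : Set.EqOn g₁ g₂ (Set.Ioo 0 π) := by
  obtain ⟨m, rfl⟩ : ∃ m, n = m + 2 := ⟨n - 2, by omega⟩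
  intro θ hθ
  refine sub_eq_zero.1 (eq_zero_of_homogeneous (m := m) (κ := κ)
    (d := fun θ => g₁ θ - g₂ θ) (d' := fun θ => deriv g₁ θ - deriv g₂ θ)
    (fun t ht => (h₁.hasDerivAt_flux ht).1.sub (h₂.hasDerivAt_flux ht).1) (fun t ht => ?_) ?_ ?_
    θ hθ)
  · refine (((h₁.hasDerivAt_flux ht).2.fun_sub (h₂.hasDerivAt_flux ht).2).congr_deriv
      (by ring)).congr_of_eventuallyEq (Filter.Eventually.of_forall fun x => by ring)
  · have := h₁.memL2.sub h₂.memL2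
    refine this.ae_eq (Filter.Eventually.of_forall fun x => ?_)
    simp only [Pi.sub_apply]
    push_cast
    ring_nf
  · have := h₁.memH10.sub h₂.memH10
    convert this using 2 with x
    push_cast
    ring_nf

/-! ### First-order expansions of `c` and `c̃` at `κ = 0` -/

lemma integral_cos_mul_sin_pow (m : ℕ) :
    ∫ θ in (0 : ℝ)..π, Real.cos θ * Real.sin θ ^ m = 0 := by
  have h : ∀ θ ∈ Set.uIcc 0 π, HasDerivAt (fun θ => Real.sin θ ^ (m + 1) / (m + 1))
      (Real.cos θ * Real.sin θ ^ m) θ := fun θ _ => by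
    refine (((Real.hasDerivAt_sin θ).fun_pow (m + 1)).div_const ((m : ℝ) + 1)).congr_deriv ?_
    have : (m : ℝ) + 1 ≠ 0 := by positivity
    push_cast
    field_simp
  rw [intervalIntegral.integral_eq_sub_of_hasDerivAt h
    (Continuous.intervalIntegrable (by fun_prop) _ _)]
  simp

lemma integral_cos_sq_mul_sin_pow (m : ℕ) :
    ∫ θ in (0 : ℝ)..π, Real.cos θ * (Real.cos θ * Real.sin θ ^ m) =
      (∫ θ in (0 : ℝ)..π, Real.sin θ ^ m) / (m + 2) := by
  have h : ∀ θ : ℝ, Real.cos θ * (Real.cos θ * Real.sin θ ^ m) =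
      Real.sin θ ^ m - Real.sin θ ^ (m + 2) := fun θ => by
    have := Real.sin_sq_add_cos_sq θ
    rw [pow_add]
    linear_combination (Real.sin θ ^ m) * this
  simp only [h]
  rw [intervalIntegral.integral_sub (Continuous.intervalIntegrable (by fun_prop) _ _)
    (Continuous.intervalIntegrable (by fun_prop) _ _), integral_sin_pow]
  have : (m : ℝ) + 2 ≠ 0 := by positivity
  simp only [Real.sin_zero, Real.sin_pi, ne_eq, Nat.add_eq_zero_iff, one_ne_zero, and_false,
    not_false_eq_true, zero_pow, zero_mul, sub_zero, zero_div, zero_add]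
  field_simp
  ring

/-- First-order expansion of the mean of `cos θ` for a density `φ κ (cos θ) sin^m θ` with
`φ κ x = a + b κ x + O(κ²)`. -/
lemma tendsto_mean_cos_div (m : ℕ) {φ : ℝ → ℝ → ℝ} {a b C δ : ℝ} (ha : a ≠ 0) (hδ : 0 < δ)
    (hcont : ∀ κ ∈ Set.Ioo 0 δ, Continuous fun θ => φ κ (Real.cos θ))
    (hφ : ∀ κ ∈ Set.Ioo 0 δ, ∀ x ∈ Set.Icc (-1 : ℝ) 1, |φ κ x - a - b * κ * x| ≤ C * κ ^ 2) :
    Filter.Tendsto (fun κ => (∫ θ in (0 : ℝ)..π, Real.cos θ * φ κ (Real.cos θ) * Real.sin θ ^ m) /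
      (∫ θ in (0 : ℝ)..π, φ κ (Real.cos θ) * Real.sin θ ^ m) / κ) (𝓝[>] 0)
      (𝓝 (b / (a * (m + 2)))) := by
  -- Used with `ψ = cos` for the numerator and `ψ = 1` for the denominator. Since `cos θ sin^m θ`
  -- has integral zero, the numerator starts at order `κ` and the denominator has no term of order
  -- `κ`.
  have key : ∀ ψ : ℝ → ℝ, Continuous ψ → (∀ θ, |ψ θ| ≤ 1) → ∀ κ ∈ Set.Ioo 0 δ,
      |(∫ θ in (0 : ℝ)..π, ψ θ * φ κ (Real.cos θ) * Real.sin θ ^ m) -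
        a * (∫ θ in (0 : ℝ)..π, ψ θ * Real.sin θ ^ m) -
        b * κ * ∫ θ in (0 : ℝ)..π, ψ θ * (Real.cos θ * Real.sin θ ^ m)| ≤ C * κ ^ 2 * π := by
    intro ψ hψ hψ1 κ hκ
    have hc : Continuous fun θ => ψ θ * φ κ (Real.cos θ) * Real.sin θ ^ m :=
      (hψ.mul (hcont κ hκ)).mul (by fun_prop)
    have hc' : Continuous fun θ => a * (ψ θ * Real.sin θ ^ m) := by fun_prop
    have hc₁ : Continuous fun θ =>
      ψ θ * φ κ (Real.cos θ) * Real.sin θ ^ m - a * (ψ θ * Real.sin θ ^ m) := hc.sub hc'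
    have hc₂ : Continuous fun θ => b * κ * (ψ θ * (Real.cos θ * Real.sin θ ^ m)) := by fun_prop
    rw [← intervalIntegral.integral_const_mul, ← intervalIntegral.integral_const_mul,
      ← intervalIntegral.integral_sub (hc.intervalIntegrable _ _) (hc'.intervalIntegrable _ _),
      ← intervalIntegral.integral_sub (hc₁.intervalIntegrable _ _) (hc₂.intervalIntegrable _ _),
      ← Real.norm_eq_abs]
    have hb := intervalIntegral.norm_integral_le_of_norm_le_const (a := 0) (b := π)
      (C := C * κ ^ 2) (f := fun θ => ψ θ * φ κ (Real.cos θ) * Real.sin θ ^ m -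
        a * (ψ θ * Real.sin θ ^ m) - b * κ * (ψ θ * (Real.cos θ * Real.sin θ ^ m)))
      (fun θ _ => by
        have h1 := hφ κ hκ (Real.cos θ) ⟨Real.neg_one_le_cos θ, Real.cos_le_one θ⟩
        have e : ψ θ * φ κ (Real.cos θ) * Real.sin θ ^ m -
            a * (ψ θ * Real.sin θ ^ m) - b * κ * (ψ θ * (Real.cos θ * Real.sin θ ^ m)) =
            (ψ θ * Real.sin θ ^ m) * (φ κ (Real.cos θ) - a - b * κ * Real.cos θ) := by ring
        rw [e, Real.norm_eq_abs, abs_mul]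
        have h2 : |ψ θ * Real.sin θ ^ m| ≤ 1 := by
          rw [abs_mul, abs_pow]
          exact mul_le_one₀ (hψ1 θ) (by positivity)
            (pow_le_one₀ (abs_nonneg _) (Real.abs_sin_le_one θ))
        exact (mul_le_of_le_one_left (abs_nonneg _) h2).trans h1)
    rwa [sub_zero, abs_of_pos Real.pi_pos] at hb
  set I : ℝ := ∫ θ in (0 : ℝ)..π, Real.sin θ ^ m with hI
  have hI0 : 0 < I := integral_sin_pow_pos m
  set N : ℝ → ℝ := fun κ => ∫ θ in (0 : ℝ)..π, Real.cos θ * φ κ (Real.cos θ) * Real.sin θ ^ m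
  set D : ℝ → ℝ := fun κ => ∫ θ in (0 : ℝ)..π, φ κ (Real.cos θ) * Real.sin θ ^ m
  have hid : Filter.Tendsto (fun κ : ℝ => κ) (𝓝[>] 0) (𝓝 0) :=
    tendsto_nhdsWithin_of_tendsto_nhds Filter.tendsto_id
  have hN : Filter.Tendsto (fun κ => N κ / κ) (𝓝[>] 0) (𝓝 (b * (I / (m + 2)))) := by
    rw [← tendsto_sub_nhds_zero_iff]
    refine squeeze_zero_norm' (a := fun κ => C * π * κ) ?_ (by simpa using hid.const_mul (C * π))
    filter_upwards [Ioo_mem_nhdsGT hδ] with κ hκ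
    have h := key Real.cos Real.continuous_cos Real.abs_cos_le_one κ hκ
    rw [integral_cos_mul_sin_pow, integral_cos_sq_mul_sin_pow, ← hI] at h
    have hk := hκ.1
    have e : N κ / κ - b * (I / (m + 2)) = (N κ - a * 0 - b * κ * (I / (m + 2))) / κ := by
      field_simp; ring
    rw [e, Real.norm_eq_abs, abs_div, abs_of_pos hk, div_le_iff₀ hk]
    exact h.trans (le_of_eq (by ring))
  have hD : Filter.Tendsto D (𝓝[>] 0) (𝓝 (a * I)) := by
    rw [← tendsto_sub_nhds_zero_iff]
    refine squeeze_zero_norm' (a := fun κ => C * π * (κ * κ)) ?_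
      (by simpa using (hid.mul hid).const_mul (C * π))
    filter_upwards [Ioo_mem_nhdsGT hδ] with κ hκ
    have h := key (fun _ => 1) continuous_const (by simp) κ hκ
    simp only [one_mul] at h
    rw [integral_cos_mul_sin_pow, ← hI, mul_zero, sub_zero] at h
    rw [Real.norm_eq_abs]
    exact h.trans (le_of_eq (by ring))
  have := hN.div hD (mul_ne_zero ha hI0.ne')
  have hm : (m : ℝ) + 2 ≠ 0 := by positivity
  have e : b * (I / (m + 2)) / (a * I) = b / (a * (m + 2)) := by field_simp
  rw [e] at this
  exact this.congr fun κ => div_right_comm _ _ _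

lemma abs_exp_mul_sub_le {κ x : ℝ} (hκ : κ ∈ Set.Ioo 0 (1 / 4)) (hx : x ∈ Set.Icc (-1 : ℝ) 1) :
    |Real.exp (κ * x) - 1 - κ * x| ≤ κ ^ 2 := by
  have h1 : |κ * x| ≤ κ := by
    rw [abs_mul, abs_of_pos hκ.1]
    exact mul_le_of_le_one_right hκ.1.le (abs_le.2 hx)
  refine (Real.abs_exp_sub_one_sub_id_le (h1.trans (by linarith [hκ.2]))).trans ?_
  rw [← sq_abs]
  gcongr

theorem tendsto_vmfOrder_div {n : ℕ} (hn : 2 ≤ n) :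
    Filter.Tendsto (fun κ => vmfOrder n κ / κ) (𝓝[>] 0) (𝓝 (1 / n)) := by
  have := tendsto_mean_cos_div (n - 2) (φ := fun κ x => Real.exp (κ * x)) (a := 1) (b := 1)
    (C := 1) (δ := 1 / 4) one_ne_zero (by norm_num) (fun κ _ => by fun_prop)
    (fun κ hκ x hx => by simpa using abs_exp_mul_sub_le hκ hx)
  have e : ((n - 2 : ℕ) : ℝ) + 2 = n := by
    rw [Nat.cast_sub hn]; norm_num
  rwa [one_mul, e] at this

/-- The series provides a solution, so the choice defining `gciProfile` is a genuine solution, and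
uniqueness equates the two on the open interval. -/
theorem exists_gciH_eq {n : ℕ} (hn : 2 ≤ n) {κ : ℝ} (hκ : κ ∈ Set.Ioo (0 : ℝ) (1 / 4)) :
    ∃ H : ℝ → ℝ, Continuous (fun θ => H (Real.cos θ)) ∧
      (∀ θ ∈ Set.Ioo 0 π, gciH n κ (Real.cos θ) = H (Real.cos θ)) ∧
      ∀ x ∈ Set.Icc (-1 : ℝ) 1,
        |H x - ((n : ℝ) - 1)⁻¹ * (1 - κ * x / (2 * n))| ≤ 8 * κ ^ 2 := by
  obtain ⟨H, D, E, cH, cD, cE, dH, dD, ode, hH⟩ :=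
    exists_profile (N := n) (by exact_mod_cast hn) hκ.1.le hκ.2.le
  have hsol := isGCISolution_of_profile hn cH cD cE dH dD ode
  have hsol' : IsGCISolution n κ (gciProfile n κ) := Classical.epsilon_spec ⟨_, hsol⟩
  refine ⟨H, cH.comp_continuous Real.continuous_cos fun θ =>
    ⟨Real.neg_one_le_cos θ, Real.cos_le_one θ⟩, fun θ hθ => ?_, hH⟩
  have hs : 0 < Real.sin θ := Real.sin_pos_of_mem_Ioo hθ
  rw [gciH, Real.arccos_cos hθ.1.le hθ.2.le, hsol'.eqOn hn hsol hθ]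
  field_simp

theorem tendsto_cTilde_div {n : ℕ} (hn : 2 ≤ n) :
    Filter.Tendsto (fun κ => cTilde n κ / κ) (𝓝[>] 0)
      (𝓝 ((2 * n - 1) / (2 * n * (n + 2)))) := by
  have hn2 : (2 : ℝ) ≤ n := by exact_mod_cast hn
  have hN1 : (0 : ℝ) < n - 1 := by linarith
  choose! H hc heq hb using fun κ (hκ : κ ∈ Set.Ioo (0 : ℝ) (1 / 4)) => exists_gciH_eq hn hκ
  set a : ℝ := ((n : ℝ) - 1)⁻¹ with ha
  have ha0 : 0 < a := inv_pos.2 hN1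
  have ha1 : a ≤ 1 := inv_le_one_of_one_le₀ (by linarith)
  -- The slope `1 - 1/(2n)` adds the contribution `1` of the exponential to `-1/(2n)` from the
  -- profile. The three remainders are at most `κ²`, `2κ²` and `16κ²`, so `20` suffices.
  have := tendsto_mean_cos_div n (φ := fun κ x => H κ x * Real.exp (κ * x)) (a := a)
    (b := a * (1 - 1 / (2 * n))) (C := 20) (δ := 1 / 4) ha0.ne' (by norm_num)
    (fun κ hκ => (hc κ hκ).mul (by fun_prop)) (fun κ hκ x hx => by
      have hr := hb κ hκ x hx
      have hq := abs_exp_mul_sub_le hκ hx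
      obtain ⟨r, hr'⟩ : ∃ r, r = H κ x - a * (1 - κ * x / (2 * n)) := ⟨_, rfl⟩
      obtain ⟨q, hq'⟩ : ∃ q, q = Real.exp (κ * x) - 1 - κ * x := ⟨_, rfl⟩
      rw [← hr'] at hr
      rw [← hq'] at hq
      have hx1 : |x| ≤ 1 := abs_le.2 hx
      have hk : |κ| = κ := abs_of_pos hκ.1
      have hkx : |κ * x| ≤ κ := by
        rw [abs_mul, hk]; exact mul_le_of_le_one_right hκ.1.le hx1
      have hy : |κ * x / (2 * n)| ≤ κ := by
        rw [abs_div, abs_of_pos (by positivity : (0 : ℝ) < 2 * n), div_le_iff₀ (by positivity)]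
        nlinarith [hκ.1]
      have hE : |Real.exp (κ * x)| ≤ 2 := by
        have h1 := abs_le.1 hq
        have h2 := abs_le.1 hkx
        rw [abs_of_pos (Real.exp_pos _)]
        nlinarith [hκ.1, hκ.2]
      have e : H κ x * Real.exp (κ * x) - a - a * (1 - 1 / (2 * n)) * κ * x =
          -(a * ((κ * x / (2 * n)) * (κ * x))) + a * ((1 - κ * x / (2 * n)) * q) +
            r * Real.exp (κ * x) := by
        rw [show H κ x = r + a * (1 - κ * x / (2 * n)) by rw [hr']; ring, hq']
        field_simp
        ring
      rw [e]
      have t1 : |-(a * ((κ * x / (2 * n)) * (κ * x)))| ≤ 1 * (κ * κ) := by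
        rw [abs_neg, abs_mul, abs_mul, abs_of_pos ha0]
        have := hκ.1
        gcongr
      have t2 : |a * ((1 - κ * x / (2 * n)) * q)| ≤ 1 * (2 * κ ^ 2) := by
        rw [abs_mul, abs_mul, abs_of_pos ha0]
        have h3 : |1 - κ * x / (2 * n)| ≤ 2 := by
          have := abs_le.1 hy
          exact abs_le.2 ⟨by linarith [hκ.2], by linarith [hκ.2]⟩
        gcongr
      have t3 : |r * Real.exp (κ * x)| ≤ 8 * κ ^ 2 * 2 := by
        rw [abs_mul]
        gcongr
      refine (abs_add_three _ _ _).trans ?_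
      nlinarith [hκ.1])
  have e : a * (1 - 1 / (2 * n)) / (a * (n + 2)) = (2 * n - 1) / (2 * n * ((n : ℝ) + 2)) := by
    field_simp
  rw [e] at this
  refine this.congr' ?_
  filter_upwards [Ioo_mem_nhdsGT (show (0 : ℝ) < 1 / 4 by norm_num)] with κ hκ
  -- At the endpoints, where the two profiles need not agree, the weight `sin^n` vanishes.
  have hpt : ∀ θ ∈ Set.uIcc 0 π, H κ (Real.cos θ) * Real.sin θ ^ n =
      gciH n κ (Real.cos θ) * Real.sin θ ^ n := by
    intro θ hθ
    rw [Set.uIcc_of_le Real.pi_pos.le] at hθ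
    rcases hθ.1.eq_or_lt with h | h
    · rw [← h, Real.sin_zero, zero_pow (by omega), mul_zero, mul_zero]
    rcases hθ.2.eq_or_lt with h' | h'
    · rw [h', Real.sin_pi, zero_pow (by omega), mul_zero, mul_zero]
    · rw [heq κ hκ θ ⟨h, h'⟩]
  rw [cTilde]
  congr 2
  · refine intervalIntegral.integral_congr fun θ hθ => ?_
    have := hpt θ hθ
    linear_combination (Real.cos θ * Real.exp (κ * Real.cos θ)) * this
  · refine intervalIntegral.integral_congr fun θ hθ => ?_
    have := hpt θ hθ
    linear_combination (Real.exp (κ * Real.cos θ)) * this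

/-! ### Diagonalizability of the symbol -/

lemma iSup_eigenspace_eq_top_of_conj_symmetric {V E : Type*} [AddCommGroup V] [Module ℝ V]
    [NormedAddCommGroup E] [InnerProductSpace ℝ E] [FiniteDimensional ℝ E] (φ : E ≃ₗ[ℝ] V)
    (A : Module.End ℝ V) (h : ∀ x y, ⟪φ.symm (A (φ x)), y⟫ = ⟪x, φ.symm (A (φ y))⟫) :
    ⨆ μ : ℝ, A.eigenspace μ = ⊤ := by
  set B : E →ₗ[ℝ] E := φ.symm.toLinearMap ∘ₗ A ∘ₗ φ.toLinearMap with hB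
  have hsymm : B.IsSymmetric := fun x y => h x y
  have htop : ⨆ μ : ℝ, Module.End.eigenspace B μ = ⊤ :=
    (Submodule.orthogonal_eq_bot_iff).1 hsymm.orthogonalComplement_iSup_eigenspaces_eq_bot
  have hmap := congrArg (Submodule.map φ.toLinearMap) htop
  rw [Submodule.map_iSup, Submodule.map_top, LinearEquiv.range] at hmap
  rw [eq_top_iff, ← hmap]
  refine iSup_mono fun μ => ?_
  rintro _ ⟨x, hx, rfl⟩
  rw [SetLike.mem_coe, Module.End.mem_eigenspace_iff] at hx
  rw [Module.End.mem_eigenspace_iff]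
  have := congrArg φ hx
  simpa [hB] using this

/-- On a real `μ`-eigenspace `A² - c` acts as `μ² - c > 0`. Diagonalizability would make it
surjective, hence injective in finite dimension, yet it kills `v`. -/
lemma iSup_eigenspace_ne_top_of_sq_neg {V : Type*} [AddCommGroup V] [Module ℝ V]
    [FiniteDimensional ℝ V] (A : Module.End ℝ V) {v : V} (hv : v ≠ 0) {c : ℝ} (hc : c < 0)
    (h : A (A v) = c • v) : ⨆ μ : ℝ, A.eigenspace μ ≠ ⊤ := by
  intro htop
  set B : V →ₗ[ℝ] V := A ∘ₗ A - c • LinearMap.id with hB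
  have hsurj : Function.Surjective B := by
    rw [← LinearMap.range_eq_top, eq_top_iff, ← htop]
    refine iSup_le fun μ x hx => ?_
    rw [Module.End.mem_eigenspace_iff] at hx
    have hne : μ * μ - c ≠ 0 := by nlinarith [mul_self_nonneg μ]
    refine ⟨(μ * μ - c)⁻¹ • x, ?_⟩
    have : B x = (μ * μ - c) • x := by
      simp [hB, hx, sub_smul, smul_smul]
    rw [map_smul, this, smul_smul, inv_mul_cancel₀ hne, one_smul]
  have hinj := LinearMap.injective_iff_surjective.2 hsurj
  refine hv (hinj ?_)
  simp [hB, h]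

lemma inner_coe_orthogonalProjection {n : ℕ} (Ω ξ : EuclideanSpace ℝ (Fin n)) (w : tangent Ω) :
    ⟪(tangent Ω).orthogonalProjectionOnto ξ, w⟫ = ⟪ξ, (w : EuclideanSpace ℝ (Fin n))⟫ := by
  rw [Submodule.inner_orthogonalProjectionOnto_eq_of_mem_right]

theorem iSup_eigenspace_symbol_eq_top {n : ℕ} {c₁ c₂ T : ℝ → ℝ} {ρ : ℝ} (hρ : 0 < ρ)
    (hc : 0 < c₁ ρ) (hT : 0 < T ρ) (Ω ξ : EuclideanSpace ℝ (Fin n)) :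
    ⨆ μ : ℝ, (symbol c₁ c₂ T ρ Ω ξ).eigenspace μ = ⊤ := by
  -- Scaling the density component by `s` changes the off-diagonal coefficients to `ρ c₁ / s` and `s
  -- T / ρ`; this `s` makes them equal. `WithLp 2` supplies the Hilbert product structure.
  set s : ℝ := Real.sqrt (ρ * c₁ ρ / (T ρ / ρ)) with hs
  have hs0 : 0 < s := by positivity
  have hss : s * s * (T ρ / ρ) = ρ * c₁ ρ := by
    rw [hs, Real.mul_self_sqrt (by positivity)]
    field_simp
  set φ : WithLp 2 (ℝ × tangent Ω) ≃ₗ[ℝ] ℝ × tangent Ω :=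
    (WithLp.linearEquiv 2 ℝ (ℝ × tangent Ω)).trans
      ((LinearEquiv.smulOfNeZero ℝ ℝ s hs0.ne').prodCongr (LinearEquiv.refl ℝ _)) with hφ
  refine iSup_eigenspace_eq_top_of_conj_symmetric φ _ fun x y => ?_
  have hφx : ∀ x, φ x = (s * x.fst, x.snd) := fun x => rfl
  have hφs : ∀ z : ℝ × tangent Ω, φ.symm z = WithLp.toLp 2 (s⁻¹ * z.1, z.2) := fun z => by
    rw [LinearEquiv.symm_apply_eq, hφx]
    ext1
    · simp [hs0.ne']
    · rfl
  have hin : ∀ x y : WithLp 2 (ℝ × tangent Ω), ⟪x, y⟫ = ⟪x.fst, y.fst⟫ + ⟪x.snd, y.snd⟫ :=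
    fun x y => WithLp.prod_inner_apply x y
  rw [hφx, hφx, hφs, hφs, hin, hin]
  simp only [WithLp.toLp_fst, WithLp.toLp_snd, symbol, LinearMap.coe_mk, AddHom.coe_mk, inner_add_left, inner_add_right,
    inner_smul_left, inner_smul_right, inner_coe_orthogonalProjection, RCLike.inner_apply,
    conj_trivial]
  rw [real_inner_comm ((tangent Ω).orthogonalProjectionOnto ξ) x.snd,
    inner_coe_orthogonalProjection, real_inner_comm y.snd x.snd, ← hss]
  field_simp
  ring

theorem iSup_eigenspace_symbol_ne_top {n : ℕ} (hn : 2 ≤ n) {c₁ c₂ T : ℝ → ℝ} {ρ : ℝ} (hρ : 0 < ρ)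
    (hc : 0 < c₁ ρ) (hT : T ρ < 0) (Ω : EuclideanSpace ℝ (Fin n)) :
    ∃ ξ, ⨆ μ : ℝ, (symbol c₁ c₂ T ρ Ω ξ).eigenspace μ ≠ ⊤ := by
  obtain ⟨ξ, hξ, hξ0⟩ : ∃ ξ ∈ tangent Ω, ξ ≠ 0 := by
    refine Submodule.exists_mem_ne_zero_of_ne_bot fun h => ?_
    have h1 := (Submodule.orthogonal_eq_bot_iff).1 h
    have h2 := finrank_span_le_card (R := ℝ) ({Ω} : Set (EuclideanSpace ℝ (Fin n)))
    rw [h1] at h2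
    simp at h2
    omega
  -- For `ξ ⊥ Ω` the diagonal terms vanish: the symbol sends `(1, 0)` to `(0, (T/ρ) ξ)` and then to
  -- `(c₁ T |ξ|², 0)`.
  refine ⟨ξ, iSup_eigenspace_ne_top_of_sq_neg _ (v := ((1 : ℝ), (0 : tangent Ω))) (by simp)
    (c := ρ * c₁ ρ * (T ρ / ρ * ⟪ξ, ξ⟫)) ?_ ?_⟩
  · have h1 : 0 < ⟪ξ, ξ⟫ := real_inner_self_pos.2 hξ0
    have h2 : T ρ / ρ < 0 := div_neg_of_neg_of_pos hT hρ
    have h3 : T ρ / ρ * ⟪ξ, ξ⟫ < 0 := mul_neg_of_neg_of_pos h2 h1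
    exact mul_neg_of_pos_of_neg (by positivity) h3
  · have hp : (tangent Ω).orthogonalProjectionOnto ξ = ⟨ξ, hξ⟩ :=
      Submodule.orthogonalProjectionOnto_mem_subspace_eq_self (⟨ξ, hξ⟩ : tangent Ω)
    have ho : ⟪Ω, ξ⟫ = 0 := Submodule.mem_orthogonal_singleton_iff_inner_right.1 hξ
    simp [symbol, hp, ho, inner_smul_right]

/-! ### The branch of equilibria near the critical density -/

lemma Rates.tau_continuousOn {ν τ : ℝ → ℝ} (h : Rates ν τ) : ContinuousOn τ (Set.Ici 0) := by
  obtain ⟨L, hL⟩ := h.tau_lipschitz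
  exact hL.continuousOn

lemma Rates.ratio_continuousOn {ν τ : ℝ → ℝ} (h : Rates ν τ) :
    ContinuousOn (ratio ν τ) (Set.Ioi 0) := by
  obtain ⟨L, hL⟩ := h.nu_div_lipschitz
  have h1 : ContinuousOn (fun s => s * (ν s / s) / τ s) (Set.Ioi 0) :=
    (continuousOn_id.mul hL.continuousOn).div
      (h.tau_continuousOn.mono Set.Ioi_subset_Ici_self) fun s hs => (h.tau_pos s (le_of_lt hs)).ne'
  refine h1.congr fun s hs => ?_
  have : s ≠ 0 := (Set.mem_Ioi.1 hs).ne'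
  simp only [ratio]
  rw [mul_div_cancel₀ _ this]

/-- Near `0`, `k(s) ≤ K s`. -/
lemma Rates.exists_ratio_le {ν τ : ℝ → ℝ} (h : Rates ν τ) :
    ∃ K > 0, ∃ s₁ > 0, ∀ s ∈ Set.Ioc 0 s₁, ratio ν τ s ≤ K * s := by
  obtain ⟨C, hC⟩ := h.nu_div_bounded
  have h0 := h.tau_pos 0 le_rfl
  have hev : ∀ᶠ s in 𝓝[>] (0 : ℝ), τ 0 / 2 < τ s :=
    ((h.tau_continuousOn 0 (by simp)).mono_left (nhdsWithin_mono _ Set.Ioi_subset_Ici_self)).eventually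
      (lt_mem_nhds (by linarith))
  obtain ⟨s₁, hs₁, hs⟩ := mem_nhdsGT_iff_exists_Ioc_subset.1 hev
  have hC0 : 0 ≤ C := (abs_nonneg _).trans (hC 1 one_pos)
  refine ⟨(C + 1) / (τ 0 / 2), by positivity, s₁, hs₁, fun s hs' => ?_⟩
  have ht : τ 0 / 2 < τ s := hs hs'
  have h1 := (le_abs_self _).trans (hC s hs'.1)
  rw [div_le_iff₀ hs'.1] at h1
  rw [ratio, div_mul_eq_mul_div]
  exact div_le_div₀ (by nlinarith [hs'.1]) (by nlinarith [hs'.1]) (by linarith) ht.le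

lemma Rates.ratio_pos {ν τ : ℝ → ℝ} (h : Rates ν τ) {s : ℝ} (hs : 0 < s) : 0 < ratio ν τ s :=
  (div_nonneg (h.nu_nonneg 0 le_rfl) (h.tau_pos 0 le_rfl).le).trans_lt
    (h.ratio_increasing (Set.mem_Ici.2 le_rfl) (Set.mem_Ici.2 hs.le) hs)

lemma Rates.inverseRatio_ratio {ν τ : ℝ → ℝ} (h : Rates ν τ) {s : ℝ} (hs : 0 ≤ s) :
    inverseRatio (ratio ν τ) (ratio ν τ s) = s :=
  h.ratio_increasing.injOn.leftInvOn_invFunOn hs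

/-- Intermediate value theorem on `[t₀, s]`; the linear bound on `k` near `0` yields a `t₀ > 0` with
`k(t₀) ≤ κ`. -/
lemma Rates.exists_ratio_eq {ν τ : ℝ → ℝ} (h : Rates ν τ) {s κ : ℝ} (hs : 0 < s) (hκ : 0 < κ)
    (hκs : κ ≤ ratio ν τ s) : ∃ t ∈ Set.Ioc 0 s, ratio ν τ t = κ := by
  obtain ⟨K, hK, s₁, hs₁, hle⟩ := h.exists_ratio_le
  set t₀ := min s (min s₁ (κ / K)) with ht₀
  have ht0 : 0 < t₀ := lt_min hs (lt_min hs₁ (by positivity))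
  have h1 : ratio ν τ t₀ ≤ κ := by
    refine (hle t₀ ⟨ht0, (min_le_right _ _).trans (min_le_left _ _)⟩).trans ?_
    rw [mul_comm, ← le_div_iff₀ hK]
    exact (min_le_right _ _).trans (min_le_right _ _)
  obtain ⟨t, ht, rfl⟩ := intermediate_value_Icc (min_le_left s (min s₁ (κ / K)))
    (h.ratio_continuousOn.mono fun x hx => ht0.trans_le hx.1) ⟨h1, hκs⟩
  exact ⟨t, ⟨ht0.trans_le ht.1, ht.2⟩, rfl⟩

lemma Rates.mem_kappaRange_of_le {ν τ : ℝ → ℝ} (h : Rates ν τ) {κ κ' : ℝ}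
    (hκ : κ ∈ kappaRange (ratio ν τ)) (h0 : 0 < κ') (hle : κ' ≤ κ) :
    κ' ∈ kappaRange (ratio ν τ) := by
  obtain ⟨s, hs, rfl⟩ := hκ
  obtain ⟨t, ht, rfl⟩ := h.exists_ratio_eq hs h0 hle
  exact ⟨t, ht.1, rfl⟩

lemma Rates.pos_of_mem_kappaRange {ν τ : ℝ → ℝ} (h : Rates ν τ) {κ : ℝ}
    (hκ : κ ∈ kappaRange (ratio ν τ)) : 0 < κ ∧ 0 < inverseRatio (ratio ν τ) κ := by
  obtain ⟨s, hs, rfl⟩ := hκ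
  exact ⟨h.ratio_pos hs, by rw [h.inverseRatio_ratio (le_of_lt hs)]; exact hs⟩

/-- The product `(j/c)(c/κ) = j/κ` tends to `ρ_c / n` and stays above `1/K`, because `k(s) ≤ K s`
near `0`. -/
lemma Rates.critical_pos {n : ℕ} (hn : 2 ≤ n) {ν τ : ℝ → ℝ} (h : Rates ν τ) {ρc : ℝ}
    (hρc : Filter.Tendsto (densityOfKappa n (ratio ν τ)) (𝓝[>] 0) (𝓝 ρc)) : 0 < ρc := by
  obtain ⟨K, hK, s₁, hs₁, hle⟩ := h.exists_ratio_le
  have hn0 : (0 : ℝ) < n := by positivity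
  have hc := tendsto_vmfOrder_div hn
  have hlim := hρc.mul hc
  have : 1 / K ≤ ρc * (1 / n) := by
    refine ge_of_tendsto hlim ?_
    have hpos : ∀ᶠ κ in 𝓝[>] (0 : ℝ), 0 < vmfOrder n κ / κ :=
      hc.eventually (lt_mem_nhds (by positivity))
    filter_upwards [Ioo_mem_nhdsGT (h.ratio_pos hs₁), hpos] with κ hκ hcκ
    obtain ⟨t, ht, rfl⟩ := h.exists_ratio_eq hs₁ hκ.1 hκ.2.le
    have hne : vmfOrder n (ratio ν τ t) ≠ 0 := by
      intro h0; rw [h0, zero_div] at hcκ; exact lt_irrefl _ hcκ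
    rw [densityOfKappa, h.inverseRatio_ratio ht.1.le, div_mul_div_cancel₀ hne,
      div_le_div_iff₀ hK hκ.1]
    linarith [hle t ht]
  have hK' : 0 < 1 / K := by positivity
  have h2 : 0 < ρc * (1 / n) := hK'.trans_le this
  exact pos_of_mul_pos_left h2 (by positivity)

lemma Rates.densityOfKappa_strictMonoOn {n : ℕ} {ν τ : ℝ → ℝ} (h : Rates ν τ)
    (hsecond : ∀ κ ∈ kappaRange (ratio ν τ), 0 < deriv (densityOfKappa n (ratio ν τ)) κ) :
    StrictMonoOn (densityOfKappa n (ratio ν τ)) (kappaRange (ratio ν τ)) := by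
  refine strictMonoOn_of_deriv_pos (Set.OrdConnected.convex ⟨fun x hx y hy z hz => ?_⟩)
    (fun κ hκ => ?_) (fun κ hκ => hsecond κ (interior_subset hκ))
  · exact h.mem_kappaRange_of_le hy ((h.pos_of_mem_kappaRange hx).1.trans_le hz.1) hz.2
  · exact (differentiableAt_of_deriv_ne_zero (hsecond κ hκ).ne').continuousAt.continuousWithinAt

/-- `F = j/c` is continuous and strictly increasing with limit `ρ_c` at `0`. For `ρ_c < ρ < F(κ₁)` a
solution exists by the intermediate value theorem, and the chosen one lies below `κ₁` by
monotonicity. -/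
theorem Rates.tendsto_kappaOf {n : ℕ} (hn : 2 ≤ n) {ν τ : ℝ → ℝ} (h : Rates ν τ) {ρc : ℝ}
    (hρc : Filter.Tendsto (densityOfKappa n (ratio ν τ)) (𝓝[>] 0) (𝓝 ρc))
    (hsecond : ∀ κ ∈ kappaRange (ratio ν τ), 0 < deriv (densityOfKappa n (ratio ν τ)) κ) :
    Filter.Tendsto (kappaOf n (ratio ν τ)) (𝓝[>] ρc) (𝓝[>] 0) := by
  have hmono := h.densityOfKappa_strictMonoOn hsecond
  have hpos := h.critical_pos hn hρc
  set k := ratio ν τ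
  set F := densityOfKappa n k
  have hcont : ∀ κ ∈ kappaRange k, ContinuousAt F κ := fun κ hκ =>
    (differentiableAt_of_deriv_ne_zero (hsecond κ hκ).ne').continuousAt
  have key : ∀ κ₁ ∈ kappaRange k, ∀ᶠ ρ in 𝓝[>] ρc, kappaOf n k ρ ∈ Set.Ioo 0 κ₁ := by
    intro κ₁ hκ₁
    have hκ₁0 := (h.pos_of_mem_kappaRange hκ₁).1
    have hhalf : κ₁ / 2 ∈ kappaRange k := h.mem_kappaRange_of_le hκ₁ (by linarith) (by linarith)
    have hlt : ρc < F κ₁ := by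
      refine lt_of_le_of_lt ?_ (hmono hhalf hκ₁ (by linarith))
      refine le_of_tendsto hρc ?_
      filter_upwards [Ioo_mem_nhdsGT (show (0 : ℝ) < κ₁ / 2 by linarith)] with κ hκ
      exact (hmono (h.mem_kappaRange_of_le hhalf hκ.1 hκ.2.le) hhalf hκ.2).le
    filter_upwards [Ioo_mem_nhdsGT hlt] with ρ hρ
    obtain ⟨κ₀, hκ₀, hFκ₀⟩ : ∃ κ₀ ∈ Set.Ioo 0 κ₁, F κ₀ < ρ :=
      (Filter.Eventually.and (Ioo_mem_nhdsGT hκ₁0)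
        (hρc.eventually (gt_mem_nhds hρ.1))).exists
    obtain ⟨κ, hκ, hFκ⟩ := intermediate_value_Icc hκ₀.2.le (fun κ hκ =>
      (hcont κ (h.mem_kappaRange_of_le hκ₁ (hκ₀.1.trans_le hκ.1) hκ.2)).continuousWithinAt)
      (show ρ ∈ Set.Icc (F κ₀) (F κ₁) from ⟨hFκ₀.le, hρ.2.le⟩)
    have hρ0 : 0 < ρ := hpos.trans hρ.1
    have hκR := h.mem_kappaRange_of_le hκ₁ (hκ₀.1.trans_le hκ.1) hκ.2
    have hex : ∃ κ, 0 < κ ∧ κ ∈ kappaRange k ∧ inverseRatio k κ = ρ * vmfOrder n κ := by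
      refine ⟨κ, hκ₀.1.trans_le hκ.1, hκR, ?_⟩
      -- Division by zero would give `F κ = 0`, contradicting `F κ = ρ > 0`; no positivity of `c` at
      -- this `κ` is required.
      have hne : vmfOrder n κ ≠ 0 := by
        intro h0
        have : F κ = 0 := by
          simp only [F, densityOfKappa, h0, div_zero]
        rw [this] at hFκ
        exact hρ0.ne hFκ
      exact (div_eq_iff hne).1 hFκ
    obtain ⟨h1, h2, h3⟩ : 0 < kappaOf n k ρ ∧ kappaOf n k ρ ∈ kappaRange k ∧
        inverseRatio k (kappaOf n k ρ) = ρ * vmfOrder n (kappaOf n k ρ) :=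
      Classical.epsilon_spec hex
    refine ⟨h1, ?_⟩
    have hne : vmfOrder n (kappaOf n k ρ) ≠ 0 := by
      intro h0
      rw [h0, mul_zero] at h3
      exact (h.pos_of_mem_kappaRange h2).2.ne' h3
    have hF : F (kappaOf n k ρ) = ρ := (div_eq_iff hne).2 h3
    exact (hmono.lt_iff_lt h2 hκ₁).1 (by rw [hF]; exact hρ.2)
  have h1 : k 1 ∈ kappaRange k := ⟨1, Set.mem_Ioi.2 one_pos, rfl⟩
  have hk1 := (h.pos_of_mem_kappaRange h1).1
  rw [tendsto_nhdsWithin_iff]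
  refine ⟨?_, (key _ h1).mono fun ρ hρ => hρ.1⟩
  rw [tendsto_order]
  refine ⟨fun a ha => (key _ h1).mono fun ρ hρ => ha.trans hρ.1, fun a ha => ?_⟩
  exact (key (min a (k 1)) (h.mem_kappaRange_of_le h1 (lt_min ha hk1) (min_le_right _ _))).mono
    fun ρ hρ => hρ.2.trans_le (min_le_left _ _)

/-! ### Behaviour of `Θ` near the critical density -/

/-- Near the critical density `κ Θ = 1 + Y (ρ - ρ_c)^{2β - 1}`, where `Y` has an explicit negative
limit. -/
theorem Rates.exists_theta_expansion {n : ℕ} (hn : 2 ≤ n) {ν τ : ℝ → ℝ} (h : Rates ν τ) {ρc : ℝ}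
    (hρc : Filter.Tendsto (densityOfKappa n (ratio ν τ)) (𝓝[>] 0) (𝓝 ρc))
    (hsecond : ∀ κ ∈ kappaRange (ratio ν τ), 0 < deriv (densityOfKappa n (ratio ν τ)) κ)
    {α₀ β : ℝ} (hα₀ : 0 < α₀)
    (hexponent : Asymptotics.IsEquivalent (𝓝[>] ρc) (orderParameter n (ratio ν τ) ρc)
      (fun ρ => α₀ * (ρ - ρc) ^ β))
    (hderiv : Asymptotics.IsEquivalent (𝓝[>] ρc) (deriv (kappaOf n (ratio ν τ)))
      (fun ρ => n * α₀ * β * (ρ - ρc) ^ (β - 1))) :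
    0 < β ∧ ∃ Y : ℝ → ℝ,
      Filter.Tendsto Y (𝓝[>] ρc) (𝓝 (-(5 * n * α₀ ^ 2 * ρc * β / (2 * (n + 2))))) ∧
      ∀ᶠ ρ in 𝓝[>] ρc, 0 < kappaOf n (ratio ν τ) ρ ∧ 0 < coeffC1 n (ratio ν τ) ρ ∧
        kappaOf n (ratio ν τ) ρ * Theta n (ratio ν τ) ρ =
          1 + Y ρ * (ρ - ρc) ^ (2 * β - 1) := by
  have hlim := h.tendsto_kappaOf hn hρc hsecond
  have hpos := h.critical_pos hn hρc
  set κ := kappaOf n (ratio ν τ)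
  have hn0 : (0 : ℝ) < n := by positivity
  have hκ0 : ∀ᶠ ρ in 𝓝[>] ρc, 0 < κ ρ :=
    hlim.eventually (eventually_mem_nhdsWithin)
  have hρ0 : ∀ᶠ ρ in 𝓝[>] ρc, ρc < ρ := eventually_mem_nhdsWithin
  have hc : Filter.Tendsto (fun ρ => vmfOrder n (κ ρ) / κ ρ) (𝓝[>] ρc) (𝓝 (1 / n)) :=
    (tendsto_vmfOrder_div hn).comp hlim
  have hct : Filter.Tendsto (fun ρ => cTilde n (κ ρ) / κ ρ) (𝓝[>] ρc)
      (𝓝 ((2 * n - 1) / (2 * n * (n + 2)))) := (tendsto_cTilde_div hn).comp hlim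
  have hcpos : ∀ᶠ ρ in 𝓝[>] ρc, 0 < vmfOrder n (κ ρ) / κ ρ :=
    hc.eventually (lt_mem_nhds (by positivity))
  have hκ' : Filter.Tendsto κ (𝓝[>] ρc) (𝓝 0) := hlim.mono_right nhdsWithin_le_nhds
  have hord : orderParameter n (ratio ν τ) ρc =ᶠ[𝓝[>] ρc] fun ρ => vmfOrder n (κ ρ) := by
    filter_upwards [hρ0] with ρ hρ
    rw [orderParameter, if_neg hρ.not_ge]
  have hexp := hexponent.congr_left hord
  -- For `β ≤ 0` the power is at least `1` near `ρ_c`, incompatible with the order parameter tending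
  -- to `0`.
  have hβ : 0 < β := by
    by_contra! hβ
    have h0 : Filter.Tendsto (fun ρ => vmfOrder n (κ ρ)) (𝓝[>] ρc) (𝓝 0) := by
      have := hc.mul hκ'
      rw [mul_zero] at this
      refine this.congr' ?_
      filter_upwards [hκ0] with ρ hρ using div_mul_cancel₀ _ hρ.ne'
    have h1 := hexp.tendsto_nhds h0
    have h2 : α₀ ≤ 0 := by
      refine ge_of_tendsto h1 ?_
      filter_upwards [Ioo_mem_nhdsGT (show ρc < ρc + 1 by linarith)] with ρ hρ
      have : 1 ≤ (ρ - ρc) ^ β :=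
        Real.one_le_rpow_of_pos_of_le_one_of_nonpos (by linarith [hρ.1]) (by linarith [hρ.2]) hβ
      nlinarith
    linarith
  refine ⟨hβ, ?_⟩
  have hu : Filter.Tendsto (fun ρ => vmfOrder n (κ ρ) / (α₀ * (ρ - ρc) ^ β)) (𝓝[>] ρc) (𝓝 1) := by
    refine (Asymptotics.isEquivalent_iff_tendsto_one ?_).1 hexp
    filter_upwards [hρ0] with ρ hρ
    have := Real.rpow_pos_of_pos (sub_pos.2 hρ) β
    positivity
  have hv : Filter.Tendsto (fun ρ => deriv κ ρ / (n * α₀ * β * (ρ - ρc) ^ (β - 1))) (𝓝[>] ρc)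
      (𝓝 1) := by
    refine (Asymptotics.isEquivalent_iff_tendsto_one ?_).1 hderiv
    filter_upwards [hρ0] with ρ hρ
    have := Real.rpow_pos_of_pos (sub_pos.2 hρ) (β - 1)
    positivity
  have hid : Filter.Tendsto (fun ρ : ℝ => ρ) (𝓝[>] ρc) (𝓝 ρc) :=
    tendsto_nhdsWithin_of_tendsto_nhds Filter.tendsto_id
  -- The correction is split into factors with known limits. The second is `κ / (α₀ (ρ - ρ_c)^β)`,
  -- routed through `c` because the critical exponent is stated for `c(κ(ρ))`; its limit is `n`.
  refine ⟨fun ρ => (cTilde n (κ ρ) / κ ρ - vmfOrder n (κ ρ) / κ ρ) *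
      (vmfOrder n (κ ρ) / (α₀ * (ρ - ρc) ^ β) / (vmfOrder n (κ ρ) / κ ρ)) *
      (deriv κ ρ / (n * α₀ * β * (ρ - ρc) ^ (β - 1))) * ρ * (n * α₀ ^ 2 * β), ?_, ?_⟩
  rotate_left
  · filter_upwards [hκ0, hρ0, hcpos] with ρ hκρ hρ hcρ
    have hx := sub_pos.2 hρ
    have hc0 : 0 < vmfOrder n (κ ρ) := by
      have := mul_pos hcρ hκρ
      rwa [div_mul_cancel₀ _ hκρ.ne'] at this
    refine ⟨hκρ, hc0, ?_⟩
    have e1 : (ρ - ρc) ^ (2 * β - 1) = (ρ - ρc) ^ β * (ρ - ρc) ^ (β - 1) := by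
      rw [← Real.rpow_add hx]; ring_nf
    have hp1 := Real.rpow_pos_of_pos hx β
    have hp2 := Real.rpow_pos_of_pos hx (β - 1)
    change κ ρ * (1 / κ ρ + (cTilde n (κ ρ) - vmfOrder n (κ ρ)) * (ρ / κ ρ) * deriv κ ρ) =
      1 + ((cTilde n (κ ρ) / κ ρ - vmfOrder n (κ ρ) / κ ρ) *
        (vmfOrder n (κ ρ) / (α₀ * (ρ - ρc) ^ β) / (vmfOrder n (κ ρ) / κ ρ)) *
        (deriv κ ρ / (n * α₀ * β * (ρ - ρc) ^ (β - 1))) * ρ * (n * α₀ ^ 2 * β)) *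
        (ρ - ρc) ^ (2 * β - 1)
    rw [e1]
    field_simp
  · have hlim2 := ((((hct.sub hc).mul (hu.div hc (by positivity))).mul hv).mul hid).mul_const
      (n * α₀ ^ 2 * β)
    have e : ((2 * (n : ℝ) - 1) / (2 * n * (n + 2)) - 1 / n) * (1 / (1 / n)) * 1 * ρc *
        (n * α₀ ^ 2 * β) = -(5 * n * α₀ ^ 2 * ρc * β / (2 * (n + 2))) := by
      field_simp
      ring
    rw [e] at hlim2
    exact hlim2

lemma sign_eq_of_pos_mul {a b c : ℝ} (ha : 0 < a) (h : SignType.sign (a * b) = SignType.sign c) :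
    SignType.sign b = SignType.sign c := by
  rw [← h, sign_mul, sign_pos ha, one_mul]

lemma sign_sqrt_sub {A α : ℝ} (hA : 0 < A) (hα : 0 < α) :
    SignType.sign (1 - α ^ 2 / A) = SignType.sign (Real.sqrt A - α) := by
  have hs := Real.sqrt_pos.2 hA
  have e : 1 - α ^ 2 / A = (A⁻¹ * (Real.sqrt A + α)) * (Real.sqrt A - α) := by
    have : A⁻¹ * (Real.sqrt A + α) * (Real.sqrt A - α) = A⁻¹ * (Real.sqrt A ^ 2 - α ^ 2) := by ring
    rw [this, Real.sq_sqrt hA.le]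
    field_simp
  rw [e, sign_mul, sign_pos (by positivity), one_mul]

lemma eventually_sign_eq {l : Filter ℝ} {f : ℝ → ℝ} {a : ℝ} (hf : Filter.Tendsto f l (𝓝 a))
    (ha : a ≠ 0) : ∀ᶠ x in l, SignType.sign (f x) = SignType.sign a := by
  rcases lt_or_gt_of_ne ha with h | h
  · filter_upwards [hf.eventually (gt_mem_nhds h)] with x hx
    rw [sign_neg hx, sign_neg h]
  · filter_upwards [hf.eventually (lt_mem_nhds h)] with x hx
    rw [sign_pos hx, sign_pos h]

end SOH

end

/-! ### The three regimes of the critical exponent -/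

theorem mainTheorem11 (n : ℕ) (hn : 2 ≤ n) (ν τ : ℝ → ℝ) (hrates : SOH.Rates ν τ)
    (k : ℝ → ℝ) (hk : k = SOH.ratio ν τ)
    (ρc : ℝ) (hρc : Filter.Tendsto (SOH.densityOfKappa n k) (𝓝[>] 0) (𝓝 ρc))
    (hsecond : ∀ κ ∈ SOH.kappaRange k, 0 < deriv (SOH.densityOfKappa n k) κ)
    (α₀ β : ℝ) (hα₀ : 0 < α₀)
    (hexponent : Asymptotics.IsEquivalent (𝓝[>] ρc) (SOH.orderParameter n k ρc)
      (fun ρ => α₀ * (ρ - ρc) ^ β))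
    (hderiv : Asymptotics.IsEquivalent (𝓝[>] ρc) (deriv (SOH.kappaOf n k))
      (fun ρ => n * α₀ * β * (ρ - ρc) ^ (β - 1))) :
    (β < 1 / 2 → ∀ᶠ ρ in 𝓝[>] ρc, SOH.Theta n k ρ < 0 ∧
      ∀ Ω : EuclideanSpace ℝ (Fin n), ‖Ω‖ = 1 → ¬ SOH.HyperbolicAt n k ρ Ω) ∧
    (1 / 2 < β → ∀ᶠ ρ in 𝓝[>] ρc, 0 < SOH.Theta n k ρ ∧
      ∀ Ω : EuclideanSpace ℝ (Fin n), ‖Ω‖ = 1 → SOH.HyperbolicAt n k ρ Ω) ∧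
    (β = 1 / 2 → α₀ ≠ Real.sqrt (4 * (n + 2) / (5 * n * ρc)) →
      ∀ᶠ ρ in 𝓝[>] ρc, SignType.sign (SOH.Theta n k ρ) =
        SignType.sign (Real.sqrt (4 * (n + 2) / (5 * n * ρc)) - α₀)) := by
  subst hk
  have hpos := hrates.critical_pos hn hρc
  obtain ⟨hβ, Y, hY, hev⟩ := hrates.exists_theta_expansion hn hρc hsecond hα₀ hexponent hderiv
  have hn0 : (0 : ℝ) < n := by positivity
  have hρ0 : ∀ᶠ ρ in 𝓝[>] ρc, ρc < ρ := eventually_mem_nhdsWithin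
  have hsub : Filter.Tendsto (fun ρ => ρ - ρc) (𝓝[>] ρc) (𝓝[>] 0) := by
    rw [tendsto_nhdsWithin_iff]
    refine ⟨?_, hρ0.mono fun ρ hρ => sub_pos.2 hρ⟩
    have : Filter.Tendsto (fun ρ : ℝ => ρ - ρc) (𝓝 ρc) (𝓝 (ρc - ρc)) :=
      Filter.tendsto_id.sub_const ρc
    rw [sub_self] at this
    exact this.mono_left nhdsWithin_le_nhds
  have hK : 0 < 5 * n * α₀ ^ 2 * ρc * β / (2 * ((n : ℝ) + 2)) := by positivity
  refine ⟨fun hβ' => ?_, fun hβ' => ?_, fun hβ' hne => ?_⟩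
  · have hbot : Filter.Tendsto (fun ρ => Y ρ * (ρ - ρc) ^ (2 * β - 1)) (𝓝[>] ρc) Filter.atBot :=
      hY.neg_mul_atTop (neg_lt_zero.2 hK)
        ((tendsto_rpow_neg_nhdsGT_zero (by linarith)).comp hsub)
    filter_upwards [hev, hρ0, hbot.eventually_lt_atBot (-1)] with ρ ⟨hκ, hc, he⟩ hρ hlt
    have hT : SOH.Theta n (SOH.ratio ν τ) ρ < 0 := by
      refine (pos_iff_neg_of_mul_neg ?_).1 hκ
      rw [he]; linarith
    refine ⟨hT, fun Ω _ hh => ?_⟩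
    obtain ⟨ξ, hξ⟩ := SOH.iSup_eigenspace_symbol_ne_top hn (c₁ := SOH.coeffC1 n (SOH.ratio ν τ))
      (c₂ := SOH.coeffC2 n (SOH.ratio ν τ)) (hpos.trans hρ) hc hT Ω
    exact hξ (hh ξ)
  · have hzero : Filter.Tendsto (fun ρ => (ρ - ρc) ^ (2 * β - 1)) (𝓝[>] ρc) (𝓝 0) := by
      have h1 : Filter.Tendsto (fun x : ℝ => x ^ (2 * β - 1)) (𝓝[>] 0) (𝓝 0) := by
        have := (Real.continuousAt_rpow_const 0 (2 * β - 1) (Or.inr (by linarith))).tendsto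
        rw [Real.zero_rpow (by linarith)] at this
        exact this.mono_left nhdsWithin_le_nhds
      exact h1.comp hsub
    have hlim := hY.mul hzero
    rw [mul_zero] at hlim
    filter_upwards [hev, hρ0, hlim.eventually (lt_mem_nhds (show (-1 : ℝ) < 0 by norm_num))] with
      ρ ⟨hκ, hc, he⟩ hρ hlt
    have hT : 0 < SOH.Theta n (SOH.ratio ν τ) ρ := by
      refine (pos_iff_pos_of_mul_pos ?_).1 hκ
      rw [he]; linarith
    exact ⟨hT, fun Ω _ ξ => SOH.iSup_eigenspace_symbol_eq_top (hpos.trans hρ) hc hT Ω ξ⟩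
  · subst hβ'
    set A : ℝ := 4 * (n + 2) / (5 * n * ρc) with hA
    have hA0 : 0 < A := by positivity
    have hlim := hY.const_add 1
    -- At `β = 1/2` the power of `ρ - ρ_c` is `1`, so `κ Θ` has a finite limit; `A` is the value of
    -- `α₀²` at which this limit vanishes.
    have e : 1 + -(5 * n * α₀ ^ 2 * ρc * (1 / 2) / (2 * ((n : ℝ) + 2))) = 1 - α₀ ^ 2 / A := by
      rw [hA]
      field_simp
      ring
    rw [e] at hlim
    have hs := SOH.sign_sqrt_sub hA0 hα₀
    have hne' : 1 - α₀ ^ 2 / A ≠ 0 := by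
      rw [← sign_ne_zero, hs, sign_ne_zero]
      exact sub_ne_zero.2 hne.symm
    filter_upwards [hev, SOH.eventually_sign_eq hlim hne'] with ρ ⟨hκ, _, he⟩ hsign
    refine SOH.sign_eq_of_pos_mul hκ ?_
    rw [he, show (2 : ℝ) * (1 / 2) - 1 = 0 by norm_num, Real.rpow_zero, mul_one, hsign, hs]
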